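/- Let $\mathcal L$ be a function of the Selberg class: $\mathcal L(s)=\sum_{n\ge1}a(n)n^{-s}$ for $\Re s>1$, where (1) $a(n)\ll_\epsilon n^\epsilon$ for every $\epsilon>0$; (2) $k\ge0$ is an integer such that $(s-1)^k\mathcal L(s)$ continues to an entire function of finite order; (3) there are an integer $f\ge1$, real numbers $Q>0$ and $\lambda_j>0$, and complex numbers $\omega,\mu_j$ ($1\le j\le f$) with $|\omega|=1$, $\Re\mu_j\ge0$, such that $\Lambda(s)=\mathcal L(s)Q^s\prod_{j=1}^f\Gamma(\lambda_js+\mu_j)$ satisfies $\Lambda(s)=\omega\overline{\Lambda(1-\bar s)}$; (4) for $\Re s>1$, $\mathcal L(s)=\prod_p\exp\big(\sum_{l\ge1}b(p^l)p^{-ls}\big)$ with $b(p^l)\ll p^{l\theta}$ for some $\theta<\tfrac12$. Put $d=2\sum_j\lambda_j$, $\lambda=\prod_j\lambda_j^{2\lambda_j}$, $\mu=4\sum_j(\tfrac12-\mu_j)$, $m_1=\max_j\frac{2|\lambda_j+\bar\mu_j|}{\lambda_j}$, $m_2=\max_j\frac{2|\mu_j|}{\lambda_j}$. Let $a_1$ be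 a constant with $|a(n)|\le a_1n$ for all $n\ge1$, let $a>2$ satisfy $\sum_{n\ge2}a_1n^{-a}<\frac12$, let $b<-3$ satisfy $\sum_{n\ge2}a_1n^{-(-b-1)}<1$, and put $R=a-b$. Let $\arg\mathcal L(\sigma+iT)$ be defined by continuous variation along the horizontal half-line from $+\infty+iT$, where it is $0$, to $\sigma+iT$; if $\mathcal L$ has a zero on the half-line $\{x+iT:x\ge\sigma\}$, put $\arg\mathcal L(\sigma+iT)=\lim_{\varepsilon\to0+}\arg\mathcal L(\sigma+i(T+\varepsilon))$. Let $I_3(T,a,b)=\int_b^a\arg\mathcal L(\sigma+iT)\,d\sigma$. With $B_2=\frac16$ put $$V^*(T)=\frac1{T-2R}\sum_{j=1}^f\frac1{\lambda_j}\Big(|\lambda_j+\bar\mu_j|^2+2\big|(\lambda_j+\bar\mu_j)(\lambda_j+\bar\mu_j-\tfrac12)\big|+|\mu_j|^2+2\big|\mu_j(\mu_j-\tfrac12)\big|+\frac{|B_2|}2\Big(2+\sec^2\Big(\frac{\arg\big(\lambda_j(-a-2R+\max\{m_1,m_2\}i)\big)}2\Big)\Big)\Big)$$ (here $\arg$ is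 the principal argument) and $$\begin{aligned}R_2(T)=\frac1{\log2}\Big(&d\big(\tfrac12-a+2R\big)\log(2T)+\log\frac{a_1\pi^2}6+V^*(T)\\&+\max\Big\{\max\big\{\tfrac52\log|\lambda Q^2|,(\tfrac12-a+2R)\log|\lambda Q^2|\big\}-2d+\Big|1-\frac{(a+2R)i}{T-2R}\Big|d\big(\tfrac12-a+2R\big)+d(a+2R)+\frac{a+2R}{T-2R}\Big|\frac{\Im\mu}2\Big|,\\&\qquad(\tfrac52d+1)\log2+k\log3+\max\big\{0,\tfrac52\log|\lambda Q^2|+\tfrac{5\sqrt5}2d+|\Im\mu|\big\}\Big\}\Big).\end{aligned}$$ Theorem. If $T\ge2R+1$, $T\ge2R+m_1$, $T>2R+m_2$ and, in case $k>0$, $T\ge2R+\frac1{2^{1/k}-1}$, then the function $\sigma\mapsto\arg\mathcal L(\sigma+iT)$ is integrable on $[b,a]$ and $$|I_3(T,a,b)|<\pi R\,(R_2(T)+2).$$ -/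

import Mathlib

open Filter Topology MeasureTheory ComplexConjugate

/-- An entire function of finite order: it is holomorphic on `ℂ` and `G(s) = O(exp(|s|^A))`
for some real `A`. -/
def IsEntireOfFiniteOrder (G : ℂ → ℂ) : Prop :=
  Differentiable ℂ G ∧ ∃ A C : ℝ, ∀ s : ℂ, ‖G s‖ ≤ C * Real.exp (‖s‖ ^ A)

/-- A function of the Selberg class, together with a choice of the order `k` in the analytic
continuation and of the data `f, Q, λ_j, μ_j, ω` of the functional equation.

The value of `toFun` at the possible pole `s = 1` plays no role. -/
structure SelbergFunction where
  /-- the Dirichlet coefficients `a(n)`, `n ≥ 1` (the value at `0` plays no role) -/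
  coeff : ℕ → ℂ
  /-- the function `L(s)`, continued to the plane -/
  toFun : ℂ → ℂ
  /-- an integer `k ≥ 0` for which `(s-1)^k L(s)` is entire of finite order -/
  k : ℕ
  /-- the number of Gamma factors -/
  f : ℕ
  Q : ℝ
  lam : Fin f → ℝ
  mu : Fin f → ℂ
  omega : ℂ
  f_pos : 0 < f
  Q_pos : 0 < Q
  lam_pos : ∀ j, 0 < lam j
  mu_re_nonneg : ∀ j, 0 ≤ (mu j).re
  norm_omega : ‖omega‖ = 1
  /-- Ramanujan hypothesis -/
  ramanujan : ∀ ε : ℝ, 0 < ε → ∃ C : ℝ, ∀ n : ℕ, 1 ≤ n → ‖coeff n‖ ≤ C * (n : ℝ) ^ ε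
  /-- the Dirichlet series, which converges absolutely for `Re s > 1` by the previous field -/
  eq_LSeries : ∀ s : ℂ, 1 < s.re → toFun s = LSeries coeff s
  /-- analytic continuation -/
  continuation : ∃ G : ℂ → ℂ, IsEntireOfFiniteOrder G ∧
    ∀ s : ℂ, s ≠ 1 → (s - 1) ^ k * toFun s = G s
  /-- functional equation `Λ(s) = ω * conj (Λ(1 - conj s))`, with
  `Λ(s) = L(s) Q^s ∏_j Γ(λ_j s + μ_j)`, at all points where no factor of either side has a pole -/
  functional_equation : ∀ s : ℂ, s ≠ 0 → s ≠ 1 →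
    (∀ (j : Fin f) (n : ℕ), (lam j : ℂ) * s + mu j ≠ -(n : ℂ)) →
    (∀ (j : Fin f) (n : ℕ), (lam j : ℂ) * (1 - conj s) + mu j ≠ -(n : ℂ)) →
    toFun s * (Q : ℂ) ^ s * ∏ j, Complex.Gamma ((lam j : ℂ) * s + mu j) =
      omega * conj (toFun (1 - conj s) * (Q : ℂ) ^ (1 - conj s) *
        ∏ j, Complex.Gamma ((lam j : ℂ) * (1 - conj s) + mu j))
  /-- Euler product; the series in the exponent converges absolutely because of the bound for
  the coefficients `b(p^l)` -/
  euler_product : ∃ (b : ℕ → ℂ) (θ C : ℝ), θ < 1 / 2 ∧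
    (∀ p l : ℕ, p.Prime → 1 ≤ l → ‖b (p ^ l)‖ ≤ C * (p : ℝ) ^ ((l : ℝ) * θ)) ∧
    ∀ s : ℂ, 1 < s.re →
      HasProd (fun p : Nat.Primes =>
        Complex.exp (∑' l : ℕ, b ((p : ℕ) ^ (l + 1)) / ((p : ℕ) : ℂ) ^ (((l : ℂ) + 1) * s)))
        (toFun s)

/-- `θ` is the argument of `F` along the horizontal half-line `{x + i Im s : x ≥ Re s}`, obtained
by continuous variation from the value `0` at `x = +∞`. In particular `F` has no zero on
the half-line. -/
def IsArgAlongRay (F : ℂ → ℂ) (s : ℂ) (θ : ℝ → ℝ) : Prop :=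
  ContinuousOn θ (Set.Ici s.re) ∧ Tendsto θ atTop (𝓝 0) ∧
    ∀ x : ℝ, s.re ≤ x → F ((x : ℂ) + (s.im : ℂ) * Complex.I) ≠ 0 ∧
      F ((x : ℂ) + (s.im : ℂ) * Complex.I) =
        (‖F ((x : ℂ) + (s.im : ℂ) * Complex.I)‖ : ℂ) * Complex.exp ((θ x : ℂ) * Complex.I)

open scoped Classical in
/-- The value at `s` of the argument of `F` obtained by continuous variation along the horizontal
half-line from `+∞ + i Im s` to `s` (and `0` if there is no such argument). -/
noncomputable def rayArg (F : ℂ → ℂ) (s : ℂ) : ℝ :=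
  if h : ∃ θ : ℝ → ℝ, IsArgAlongRay F s θ then h.choose s.re else 0

open scoped Classical in
/-- `arg F(s)`, the imaginary part of the branch of `log F` which tends to `0` as `Re s → +∞` and is
continued horizontally to the left. If there is a zero on the half-line to the right of `s`
(or at `s`), it is the limit from above, `lim_{ε → 0+} arg F(s + iε)`. -/
noncomputable def contArg (F : ℂ → ℂ) (s : ℂ) : ℝ :=
  if ∃ θ : ℝ → ℝ, IsArgAlongRay F s θ then rayArg F s
  else limUnder (𝓝[>] (0 : ℝ)) (fun ε : ℝ => rayArg F (s + (ε : ℂ) * Complex.I))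

namespace SelbergFunction

/-- The degree `d_L = 2 ∑ λ_j`. -/
noncomputable def degree (L : SelbergFunction) : ℝ := 2 * ∑ j, L.lam j

/-- `λ = ∏ λ_j ^ (2 λ_j)`. -/
noncomputable def lamProd (L : SelbergFunction) : ℝ := ∏ j, (L.lam j) ^ (2 * L.lam j)

/-- `μ = 4 ∑ (1/2 - μ_j)`. -/
noncomputable def muSum (L : SelbergFunction) : ℂ := 4 * ∑ j, (1 / 2 - L.mu j)

/-- `max_j 2|λ_j + conj μ_j| / λ_j`. -/
noncomputable def maxShift (L : SelbergFunction) : ℝ :=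
  ⨆ j, 2 * ‖(L.lam j : ℂ) + conj (L.mu j)‖ / L.lam j

/-- `max_j 2|μ_j| / λ_j`. -/
noncomputable def maxMu (L : SelbergFunction) : ℝ := ⨆ j, 2 * ‖L.mu j‖ / L.lam j

/-- The integral `I_3(T, a, b) = ∫_b^a arg L(σ + iT) dσ`. -/
noncomputable def I3 (L : SelbergFunction) (T a b : ℝ) : ℝ :=
  ∫ σ in b..a, contArg L.toFun ((σ : ℂ) + (T : ℂ) * Complex.I)

/-- The quantity `V^*(T)`, with `R = a - b`. -/
noncomputable def VStar (L : SelbergFunction) (a b T : ℝ) : ℝ :=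
  let R := a - b
  1 / (T - 2 * R) * ∑ j, 1 / L.lam j *
    (‖(L.lam j : ℂ) + conj (L.mu j)‖ ^ 2
      + 2 * ‖((L.lam j : ℂ) + conj (L.mu j)) * ((L.lam j : ℂ) + conj (L.mu j) - 1 / 2)‖
      + ‖L.mu j‖ ^ 2
      + 2 * ‖L.mu j * (L.mu j - 1 / 2)‖
      + |((bernoulli 2 : ℚ) : ℝ)| / 2 *
        (2 + (1 / Real.cos (Complex.arg ((L.lam j : ℂ) *
          (((-a - 2 * R : ℝ) : ℂ) + ((max L.maxShift L.maxMu : ℝ) : ℂ) * Complex.I)) / 2)) ^ 2))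

/-- The quantity `R_2(T)`, with `R = a - b`; `a₁` is the constant in `|a(n)| ≤ a₁ n`. -/
noncomputable def R2 (L : SelbergFunction) (a₁ a b T : ℝ) : ℝ :=
  let R := a - b
  let d := L.degree
  let logLQ := Real.log |L.lamProd * L.Q ^ 2|
  1 / Real.log 2 *
    (d * (1 / 2 - a + 2 * R) * Real.log (2 * T) + Real.log (a₁ * Real.pi ^ 2 / 6)
      + L.VStar a b T
      + max
          (max (5 / 2 * logLQ) ((1 / 2 - a + 2 * R) * logLQ) - 2 * d
            + ‖(1 : ℂ) - (((a + 2 * R) / (T - 2 * R) : ℝ) : ℂ) * Complex.I‖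
                * d * (1 / 2 - a + 2 * R)
            + d * (a + 2 * R)
            + (a + 2 * R) / (T - 2 * R) * |L.muSum.im / 2|)
          ((5 / 2 * d + 1) * Real.log 2 + L.k * Real.log 3
            + max 0 (5 / 2 * logLQ + 5 * Real.sqrt 5 / 2 * d + |L.muSum.im|)))

end SelbergFunction

/-!
The proof is Backlund's method. Along the half-line ending at `σ + iT` the argument of `L` can change
by `π` only by passing a zero of `Re L`, so `|arg L(σ + iT)| ≤ π (n + 1/2)`, where `n` is the number of
zeros of `x ↦ Re L(x + iT)` on `[σ, ∞)` (`IsArgAlongRay.abs_le_of_card_le`). It suffices to show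
`n + 1/2 < R₂(T) + 2` with a margin, for `σ ≥ b` and `R = a - b`.

The hypothesis on `a` gives `|L - 1| < 1/2` for `Re s ≥ a + 1`, because the bound for the coefficients
is `a₁ n`, which costs one unit in the exponent. Hence all zeros counted by `n` lie in
`[b, a + 1]`, that is, within `R + 1` of `c = a + 1`. They are zeros of the function
`(F(z) + conj (F(conj z))) / 2`, where `F(z) = L(z + iT)`, and Jensen's formula on the circle of
radius `2R` about `c`, divided by `log (2R / (R + 1)) ≥ 1/2`, bounds their number in terms of upper bounds
for `log |F|` on the two halves of this circle (`card_re_zeros_mul_log_le`). The right half lies in the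
half-plane where `|L| ≤ 3/2` and contributes little, so the mean is about half of the bound on the
left half; this gains the factor `2` which the logarithm `1/2` loses.

On the left half, `log |L|` is at most `1.44 log 2 · R₂(T) - 0.47`
(`SelbergFunction.norm_le_exp_logBound`).
For `Re s ≥ 3` this is the Dirichlet series. For `Re s ≤ -2` the functional equation reduces it to a
bound for `|Γ(z + δ) / Γ(z)|`, and `norm_Gamma_add_real_le` gives `(e |z + δ + 2|) ^ δ`. This is proved
from Euler's limit formula for `Γ`, without Stirling's formula: `x ↦ log |x + iy|` is concave up to an
error that telescopes over unit steps, so that `x ↦ log |Γ(x + iy)|` is convex up to a bounded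
error. For `-2 ≤ Re s ≤ 3` the Phragmén–Lindelöf principle is applied to the quotient of
`(s - 1)^k L(s)` by an explicit holomorphic majorant (`SelbergFunction.norm_toFun_le_of_mem_strip`).

If there are zeros on the line `Im s = T`, then `contArg` is a limit from above. The zeros of `L` above
the segment `[b, a + 1] + iT` do not accumulate at it, so the argument along each line `Im s = T + ε`,
with `ε > 0` small, exists and is continuous in `σ`. Away from the finitely many zeros on the line itself
it tends to `contArg` as `ε → 0+` (`tendsto_rayArg_contArg`). Hence `contArg` is almost everywhere
a pointwise limit of continuous functions which are uniformly bounded, as `R₂` is continuous in `T`; this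
gives both its integrability and the bound for the integral.
-/

/-! ### Growth of the Gamma function along horizontal lines -/

/-- `v * √(v² + y²)` is log-concave on `(0, ∞)`; its logarithm is written as a sum. -/
lemma concaveOn_log_add_half_log_sq_add_sq (y : ℝ) :
    ConcaveOn ℝ (Set.Ioi 0) (fun v : ℝ => Real.log (v ^ 2 + y ^ 2) / 2 + Real.log v) := by
  have hder : ∀ v : ℝ, 0 < v → HasDerivAt
      (fun v : ℝ => Real.log (v ^ 2 + y ^ 2) / 2 + Real.log v) (v / (v ^ 2 + y ^ 2) + v⁻¹) v := by
    intro v hv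
    have hpos : 0 < v ^ 2 + y ^ 2 := by positivity
    have h1 : HasDerivAt (fun v : ℝ => v ^ 2 + y ^ 2) (2 * v) v := by
      simpa using (hasDerivAt_pow 2 v).add_const (y ^ 2)
    have e : v / (v ^ 2 + y ^ 2) = 2 * v / (v ^ 2 + y ^ 2) / 2 := by ring
    rw [e]
    exact ((h1.log hpos.ne').div_const 2).add (Real.hasDerivAt_log hv.ne')
  refine AntitoneOn.concaveOn_of_deriv (convex_Ioi 0)
    (fun v hv => (hder v hv).continuousAt.continuousWithinAt)
    (fun v hv => ?_) ?_
  · rw [interior_Ioi] at hv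
    exact (hder v hv).differentiableAt.differentiableWithinAt
  · rw [interior_Ioi]
    intro v hv w hw hvw
    have hv' : 0 < v := hv
    have hw' : 0 < w := hw
    rw [(hder v hv).deriv, (hder w hw).deriv]
    have hV : 0 < v ^ 2 + y ^ 2 := by positivity
    have hW : 0 < w ^ 2 + y ^ 2 := by positivity
    have key : v / (v ^ 2 + y ^ 2) + v⁻¹ - (w / (w ^ 2 + y ^ 2) + w⁻¹) =
        (w - v) * ((w ^ 2 + y ^ 2) * (v ^ 2 + y ^ 2) - (y ^ 2 - v * w) * (v * w)) /
          ((w ^ 2 + y ^ 2) * (v ^ 2 + y ^ 2) * (v * w)) := by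
      field_simp
      ring
    have : 0 ≤ (w - v) * ((w ^ 2 + y ^ 2) * (v ^ 2 + y ^ 2) - (y ^ 2 - v * w) * (v * w)) /
          ((w ^ 2 + y ^ 2) * (v ^ 2 + y ^ 2) * (v * w)) := by
      apply div_nonneg _ (by positivity)
      apply mul_nonneg (by linarith)
      have h2 : 0 < v * w := by positivity
      nlinarith [sq_nonneg (v * w), sq_nonneg (y ^ 2), sq_nonneg (v * y), sq_nonneg (w * y),
        mul_nonneg h2.le (sq_nonneg y), sq_nonneg (v * y - w * y)]
    linarith

lemma log_norm_eq_half_log (z : ℂ) : Real.log ‖z‖ = Real.log (z.re ^ 2 + z.im ^ 2) / 2 := by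
  rw [Complex.norm_eq_sqrt_sq_add_sq, Real.log_sqrt (by positivity)]

/-- The function `x ↦ log |x + iy|` is concave up to an error which telescopes over unit steps. -/
lemma log_norm_interpolation {w : ℂ} (hw : 0 < w.re) {θ : ℝ} (h0 : 0 ≤ θ) (h1 : θ ≤ 1) :
    Real.log ‖w‖ - Real.log ‖w + θ‖ ≤
      θ * (Real.log ‖w‖ - Real.log ‖w + 1‖) + θ * (1 / w.re - 1 / (w.re + 1)) := by
  have hc := (concaveOn_log_add_half_log_sq_add_sq w.im).2 (Set.mem_Ioi.2 hw)
    (Set.mem_Ioi.2 (show 0 < w.re + 1 by linarith)) (sub_nonneg.2 h1) h0 (by ring)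
  simp only [smul_eq_mul] at hc
  have e : (1 - θ) * w.re + θ * (w.re + 1) = w.re + θ := by ring
  rw [e] at hc
  rw [log_norm_eq_half_log, log_norm_eq_half_log (w + θ), log_norm_eq_half_log (w + 1)]
  simp only [Complex.add_re, Complex.add_im, Complex.ofReal_re, Complex.ofReal_im, add_zero,
    Complex.one_re, Complex.one_im]
  set u := w.re
  have h2 : Real.log (u + θ) - Real.log u ≤ θ * (1 / u) := by
    rw [← Real.log_div (by positivity) hw.ne']
    refine (Real.log_le_sub_one_of_pos (by positivity)).trans (le_of_eq ?_)
    field_simp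
    ring
  have h3 : Real.log u - Real.log (u + 1) ≤ - (1 / (u + 1)) := by
    rw [← Real.log_div hw.ne' (by positivity)]
    refine (Real.log_le_sub_one_of_pos (by positivity)).trans (le_of_eq ?_)
    field_simp
    ring
  nlinarith [mul_le_mul_of_nonneg_left h3 h0]

lemma norm_pos_of_re_pos {z : ℂ} (hz : 0 < z.re) : 0 < ‖z‖ :=
  hz.trans_le (Complex.re_le_norm z)

lemma sum_log_norm_shift_le {w : ℂ} (hw : 0 < w.re) {θ : ℝ} (h0 : 0 ≤ θ) (h1 : θ ≤ 1) (n : ℕ) :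
    ∑ j ∈ Finset.range n, (Real.log ‖w + j‖ - Real.log ‖w + θ + j‖) ≤
      θ * (Real.log ‖w‖ - Real.log ‖w + n‖) + θ * (1 / w.re - 1 / (w.re + n)) := by
  induction n with
  | zero => simp
  | succ n ih =>
    rw [Finset.sum_range_succ]
    have h := log_norm_interpolation (w := w + n) (by simp; positivity) h0 h1
    have e1 : w + n + θ = w + θ + n := by ring
    rw [e1] at h
    push_cast
    simp only [Complex.add_re, Complex.natCast_re] at h
    rw [← add_assoc w, ← add_assoc w.re]
    linarith

/-- For `Re w ≥ 1` the function `θ ↦ |Γ(w + θ)|` on `[0, 1]` is at most `|Γ(w)| (e|w|) ^ θ`. -/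
lemma norm_Gamma_add_le {w : ℂ} (hw : 1 ≤ w.re) {θ : ℝ} (h0 : 0 ≤ θ) (h1 : θ ≤ 1) :
    ‖Complex.Gamma (w + θ)‖ ≤ ‖Complex.Gamma w‖ * (Real.exp 1 * ‖w‖) ^ θ := by
  have hw0 : 0 < w.re := by linarith
  have hwn : 0 < ‖w‖ := norm_pos_of_re_pos hw0
  refine le_of_tendsto_of_tendsto (Complex.GammaSeq_tendsto_Gamma (w + θ)).norm
    ((Complex.GammaSeq_tendsto_Gamma w).norm.mul_const _) ?_
  filter_upwards [eventually_gt_atTop 0] with n hn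
  have hn' : (0 : ℝ) < n := by exact_mod_cast hn
  have hposj : ∀ j : ℕ, 0 < ‖w + j‖ := fun j => norm_pos_of_re_pos (by simp; positivity)
  have hposj' : ∀ j : ℕ, 0 < ‖w + θ + j‖ := fun j => norm_pos_of_re_pos (by simp; positivity)
  have hsum := sum_log_norm_shift_le hw0 h0 h1 (n + 1)
  have hlast : (n : ℝ) ≤ ‖w + (n + 1 : ℕ)‖ := by
    refine le_trans ?_ (Complex.re_le_norm _)
    simp; linarith
  have hlog : Real.log n ≤ Real.log ‖w + (n + 1 : ℕ)‖ := Real.log_le_log hn' hlast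
  have hre : 1 / w.re - 1 / (w.re + (n + 1 : ℕ)) ≤ 1 := by
    have : 1 / w.re ≤ 1 := by rw [div_le_one hw0]; exact hw
    have : 0 ≤ 1 / (w.re + (n + 1 : ℕ)) := by positivity
    linarith
  have hsum' : ∑ j ∈ Finset.range (n + 1), (Real.log ‖w + j‖ - Real.log ‖w + θ + j‖) +
      θ * Real.log n ≤ θ * (1 + Real.log ‖w‖) := by
    nlinarith [mul_le_mul_of_nonneg_left hlog h0, mul_le_mul_of_nonneg_left hre h0]
  simp only [Complex.GammaSeq, norm_div, norm_mul, norm_prod,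
    Complex.norm_natCast_cpow_of_pos hn]
  have hA : 0 < ∏ j ∈ Finset.range (n + 1), ‖w + j‖ := Finset.prod_pos fun j _ => hposj j
  have hB : 0 < ∏ j ∈ Finset.range (n + 1), ‖w + θ + j‖ := Finset.prod_pos fun j _ => hposj' j
  have hkey : (n : ℝ) ^ θ * (∏ j ∈ Finset.range (n + 1), ‖w + j‖) ≤
      (Real.exp 1 * ‖w‖) ^ θ * ∏ j ∈ Finset.range (n + 1), ‖w + θ + j‖ := by
    rw [← Real.log_le_log_iff (by positivity) (by positivity), Real.log_mul (by positivity) hA.ne',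
      Real.log_mul (by positivity) hB.ne', Real.log_rpow hn', Real.log_rpow (by positivity),
      Real.log_mul (Real.exp_ne_zero _) hwn.ne', Real.log_exp,
      Real.log_prod (fun j _ => (hposj j).ne'), Real.log_prod (fun j _ => (hposj' j).ne')]
    rw [Finset.sum_sub_distrib] at hsum'
    linarith
  simp only [Complex.add_re, Complex.ofReal_re]
  rw [Real.rpow_add hn', div_mul_eq_mul_div, div_le_div_iff₀ hB hA]
  have hC : 0 ≤ (n : ℝ) ^ w.re * ‖((n.factorial : ℕ) : ℂ)‖ := by positivity
  nlinarith [mul_le_mul_of_nonneg_left hkey hC]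

lemma norm_Gamma_add_nat_le {w : ℂ} (m : ℕ) (hw : ∀ n : ℕ, w ≠ -n) {K : ℝ}
    (hK : ∀ i < m, ‖w + i‖ ≤ K) :
    ‖Complex.Gamma (w + m)‖ ≤ ‖Complex.Gamma w‖ * K ^ m := by
  induction m with
  | zero => simp
  | succ m ih =>
    have hne : w + m ≠ 0 := fun h => hw m (eq_neg_of_add_eq_zero_left h)
    have e : w + ((m + 1 : ℕ) : ℂ) = w + m + 1 := by push_cast; ring
    rw [e, Complex.Gamma_add_one _ hne, norm_mul, pow_succ]
    have h1 := ih fun i hi => hK i (by omega)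
    have h2 := hK m (by omega)
    have h3 : 0 ≤ ‖Complex.Gamma w‖ * K ^ m := le_trans (norm_nonneg _) h1
    calc _ ≤ K * (‖Complex.Gamma w‖ * K ^ m) := mul_le_mul h2 h1 (norm_nonneg _) ((norm_nonneg _).trans h2)
      _ = _ := by ring

/-- Moving `z` to the right by `δ`, from a point whose real part is at least `-Re (z + δ)`,
multiplies `|Γ|` by at most `(e |z + δ + 2|) ^ δ`. The shift by `2` moves the comparison to a
half-plane in which `|Γ|` is essentially log-convex; it costs nothing since
`|z + n| ≤ |z + δ + n|`. -/
lemma norm_Gamma_add_real_le {z : ℂ} {δ : ℝ} (hδ : 0 ≤ δ) (hz : 0 < z.re + δ)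
    (hz' : -z.re ≤ z.re + δ) (hpole : ∀ n : ℕ, z ≠ -n) :
    ‖Complex.Gamma (z + δ)‖ ≤
      ‖Complex.Gamma z‖ * (Real.exp 1 * ‖z + δ + 2‖) ^ δ := by
  have hle : ∀ (n : ℕ) (θ : ℝ), 0 ≤ θ → θ ≤ δ → ‖z + θ + n‖ ≤ ‖z + δ + n‖ := by
    intro n θ h0 h1
    rw [Complex.norm_eq_sqrt_sq_add_sq, Complex.norm_eq_sqrt_sq_add_sq]
    apply Real.sqrt_le_sqrt
    simp only [Complex.add_re, Complex.add_im, Complex.ofReal_re, Complex.ofReal_im,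
      Complex.natCast_re, Complex.natCast_im]
    have hn : (0 : ℝ) ≤ n := n.cast_nonneg
    nlinarith
  have hz1 : z + δ ≠ 0 := fun h => by
    have := congrArg Complex.re h
    simp at this; linarith
  have hz2 : z + δ + 1 ≠ 0 := fun h => by
    have := congrArg Complex.re h
    simp at this; linarith
  have hz0 : z ≠ 0 := by simpa using hpole 0
  have hz01 : z + 1 ≠ 0 := fun h => hpole 1 (by simpa using eq_neg_of_add_eq_zero_left h)
  -- the shifted comparison
  have hshift : ‖Complex.Gamma (z + 2 + δ)‖ ≤
      ‖Complex.Gamma (z + 2)‖ * (Real.exp 1 * ‖z + δ + 2‖) ^ δ := by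
    set m := ⌊δ⌋₊
    set θ := δ - m
    have hθ0 : 0 ≤ θ := sub_nonneg.2 (Nat.floor_le hδ)
    have hθ1 : θ ≤ 1 := by have := Nat.lt_floor_add_one δ; simp only [θ, m]; linarith
    have hKpos : 0 < ‖z + δ + 2‖ := norm_pos_of_re_pos (by simp; linarith)
    have hmδ : (m : ℝ) ≤ δ := Nat.floor_le hδ
    have h1 := norm_Gamma_add_le (w := z + 2 + m) (by
      have : (m : ℝ) = δ - θ := by simp [θ]
      simp [this]; linarith) hθ0 hθ1
    have h2 := norm_Gamma_add_nat_le (w := z + 2) m (fun n h => hpole (n + 2) (by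
      push_cast; rw [eq_sub_of_add_eq h]; ring)) (K := ‖z + δ + 2‖) (fun i hi => by
        have := hle 2 i (by positivity) ((Nat.cast_le.2 hi.le).trans hmδ)
        push_cast at this
        rwa [add_right_comm])
    have h3 : ‖z + 2 + m‖ ≤ ‖z + δ + 2‖ := by
      have := hle 2 m (by positivity) hmδ
      push_cast at this
      rwa [add_right_comm]
    have e : z + 2 + m + (θ : ℂ) = z + 2 + δ := by simp only [θ]; push_cast; ring
    rw [e] at h1
    have hexp : (1 : ℝ) ≤ Real.exp 1 := Real.one_le_exp zero_le_one
    calc ‖Complex.Gamma (z + 2 + δ)‖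
        ≤ ‖Complex.Gamma (z + 2 + m)‖ * (Real.exp 1 * ‖z + 2 + m‖) ^ θ := h1
      _ ≤ (‖Complex.Gamma (z + 2)‖ * (Real.exp 1 * ‖z + δ + 2‖) ^ m) *
          (Real.exp 1 * ‖z + δ + 2‖) ^ θ := by
          gcongr
          refine h2.trans ?_
          gcongr
          nlinarith
      _ = _ := by
          rw [mul_assoc, ← Real.rpow_natCast, ← Real.rpow_add (by positivity)]
          simp [θ]
  have e1 : Complex.Gamma (z + 2 + δ) = (z + δ + 1) * ((z + δ) * Complex.Gamma (z + δ)) := by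
    rw [← Complex.Gamma_add_one _ hz1, ← Complex.Gamma_add_one _ hz2]
    congr 1; ring
  have e2 : Complex.Gamma (z + 2) = (z + 1) * (z * Complex.Gamma z) := by
    rw [← Complex.Gamma_add_one _ hz0, ← Complex.Gamma_add_one _ hz01]
    congr 1; ring
  rw [e1, e2] at hshift
  simp only [norm_mul] at hshift
  have l0 := hle 0 0 le_rfl hδ
  have l1 := hle 1 0 le_rfl hδ
  simp only [Complex.ofReal_zero, add_zero, Nat.cast_zero, Nat.cast_one] at l0 l1
  have p0 : 0 < ‖z + δ‖ := norm_pos_iff.2 hz1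
  have p1 : 0 < ‖z + δ + 1‖ := norm_pos_iff.2 hz2
  refine le_of_mul_le_mul_left ?_ (mul_pos p1 p0)
  calc _ = ‖z + δ + 1‖ * (‖z + δ‖ * ‖Complex.Gamma (z + δ)‖) := by ring
    _ ≤ _ := hshift
    _ ≤ ‖z + δ + 1‖ * (‖z + δ‖ * ‖Complex.Gamma z‖) * (Real.exp 1 * ‖z + δ + 2‖) ^ δ := by
        gcongr
    _ = _ := by ring

/-! ### The Dirichlet series in its half-plane of absolute convergence -/

namespace SelbergFunction

variable (L : SelbergFunction)

lemma coeff_bound_nonneg {a₁ : ℝ} (ha₁ : ∀ n : ℕ, 1 ≤ n → ‖L.coeff n‖ ≤ a₁ * n) : 0 ≤ a₁ := by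
  simpa using (norm_nonneg _).trans (ha₁ 1 le_rfl)

lemma norm_term_le {a₁ : ℝ} (ha₁ : ∀ n : ℕ, 1 ≤ n → ‖L.coeff n‖ ≤ a₁ * n) {σ : ℝ} {s : ℂ}
    (hs : σ + 1 ≤ s.re) (n : ℕ) (hn : 1 ≤ n) :
    ‖LSeries.term L.coeff s n‖ ≤ a₁ / (n : ℝ) ^ σ := by
  have hn0 : (0 : ℝ) < n := by exact_mod_cast hn
  rw [LSeries.term_of_ne_zero (by omega), norm_div, Complex.norm_natCast_cpow_of_pos hn]
  have h1 : (n : ℝ) * (n : ℝ) ^ σ ≤ (n : ℝ) ^ s.re := by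
    rw [mul_comm, ← Real.rpow_add_one hn0.ne']
    exact Real.rpow_le_rpow_of_exponent_le (by exact_mod_cast hn) hs
  rw [div_le_div_iff₀ (by positivity) (by positivity)]
  have := L.coeff_bound_nonneg ha₁
  calc ‖L.coeff n‖ * (n : ℝ) ^ σ ≤ a₁ * n * (n : ℝ) ^ σ := by gcongr; exact ha₁ n hn
    _ = a₁ * (n * (n : ℝ) ^ σ) := by ring
    _ ≤ _ := by gcongr

lemma norm_toFun_le_of_three_le_re {a₁ : ℝ} (ha₁ : ∀ n : ℕ, 1 ≤ n → ‖L.coeff n‖ ≤ a₁ * n) {s : ℂ}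
    (hs : 3 ≤ s.re) : ‖L.toFun s‖ ≤ a₁ * Real.pi ^ 2 / 6 := by
  rw [L.eq_LSeries s (by linarith), LSeries, mul_div_assoc]
  refine tsum_of_norm_bounded (hasSum_zeta_two.mul_left a₁) fun n => ?_
  rcases Nat.eq_zero_or_pos n with rfl | hn
  · simp
  · have := L.norm_term_le ha₁ (σ := 2) (by linarith) n hn
    rw [mul_one_div]
    exact_mod_cast this

lemma summable_tail {a₁ a : ℝ} (ha : 1 < a) :
    Summable fun n : ℕ => a₁ / ((n : ℝ) + 2) ^ a := by
  have h := (summable_nat_add_iff 2).2 (Real.summable_one_div_nat_rpow.2 ha)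
  simpa [div_eq_mul_inv] using h.mul_left a₁

/-- The distance of `L(s)` from the first coefficient decays exponentially as `Re s → +∞`. -/
lemma norm_toFun_sub_coeff_one_le {a₁ a : ℝ} (ha₁ : ∀ n : ℕ, 1 ≤ n → ‖L.coeff n‖ ≤ a₁ * n)
    (ha : 2 < a) {r : ℝ} (hr : 0 ≤ r) {s : ℂ} (hs : a + 1 + r ≤ s.re) :
    ‖L.toFun s - L.coeff 1‖ ≤ (∑' n : ℕ, a₁ / ((n : ℝ) + 2) ^ a) * (2 : ℝ) ^ (-r) := by
  have h0 := L.coeff_bound_nonneg ha₁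
  have hbound : ∀ n : ℕ, ‖LSeries.term L.coeff s (n + 2)‖ ≤
      a₁ / ((n : ℝ) + 2) ^ a * (2 : ℝ) ^ (-r) := by
    intro n
    refine (L.norm_term_le ha₁ (σ := a + r) (by linarith) (n + 2) (by omega)).trans ?_
    have h2 : (0 : ℝ) < (n : ℝ) + 2 := by positivity
    push_cast
    rw [Real.rpow_add h2, Real.rpow_neg zero_le_two, ← div_eq_mul_inv, div_div]
    gcongr
    linarith [(n.cast_nonneg : (0 : ℝ) ≤ n)]
  have hsum : Summable fun n : ℕ => LSeries.term L.coeff s (n + 2) :=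
    Summable.of_norm_bounded ((summable_tail (by linarith)).mul_right _) hbound
  have hsum' : Summable (LSeries.term L.coeff s) := (summable_nat_add_iff 2).1 hsum
  rw [L.eq_LSeries s (by linarith), LSeries, ← hsum'.sum_add_tsum_nat_add 2]
  have e : ∑ i ∈ Finset.range 2, LSeries.term L.coeff s i = L.coeff 1 := by
    simp [Finset.sum_range_succ, LSeries.term_def]
  rw [e, add_sub_cancel_left, ← tsum_mul_right]
  exact tsum_of_norm_bounded ((summable_tail (by linarith)).mul_right _).hasSum hbound

lemma tendsto_two_rpow_neg : Tendsto (fun x : ℝ => (2 : ℝ) ^ (-x)) atTop (𝓝 0) := by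
  have := tendsto_rpow_atTop_of_base_lt_one (2⁻¹ : ℝ) (by norm_num) (by norm_num)
  refine this.congr fun x => ?_
  rw [Real.inv_rpow zero_le_two, Real.rpow_neg zero_le_two]

/-- The Dirichlet series tends to its first coefficient, uniformly in the imaginary part. -/
lemma tendsto_toFun_coeff_one {a₁ a : ℝ} (ha₁ : ∀ n : ℕ, 1 ≤ n → ‖L.coeff n‖ ≤ a₁ * n)
    (ha : 2 < a) (y : ℝ) :
    Tendsto (fun x : ℝ => L.toFun (x + y * Complex.I)) atTop (𝓝 (L.coeff 1)) := by
  rw [tendsto_iff_norm_sub_tendsto_zero]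
  have h : Tendsto (fun x : ℝ => (∑' n : ℕ, a₁ / ((n : ℝ) + 2) ^ a) *
      (2 : ℝ) ^ (-(x - (a + 1)))) atTop (𝓝 0) := by
    have := (tendsto_two_rpow_neg.comp (tendsto_atTop_add_const_right atTop (-(a + 1))
      tendsto_id)).const_mul (∑' n : ℕ, a₁ / ((n : ℝ) + 2) ^ a)
    simpa [Function.comp_def, sub_eq_add_neg] using this
  refine squeeze_zero' (Eventually.of_forall fun _ => norm_nonneg _) ?_ h
  filter_upwards [eventually_ge_atTop (a + 1)] with x hx
  exact L.norm_toFun_sub_coeff_one_le ha₁ ha (by linarith) (by simp)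

/-- By the Euler product, `L(x) → 1` as `x → +∞`. -/
lemma tendsto_toFun_one : Tendsto (fun x : ℝ => L.toFun x) atTop (𝓝 1) := by
  obtain ⟨b, θ, C, hθ, hb, hprod⟩ := L.euler_product
  have hC : 0 ≤ C := by
    have h := (norm_nonneg _).trans (hb 2 1 Nat.prime_two le_rfl)
    exact nonneg_of_mul_nonneg_left h (by positivity)
  set f : ℝ → Nat.Primes → ℂ := fun x p =>
    ∑' l : ℕ, b ((p : ℕ) ^ (l + 1)) / ((p : ℕ) : ℂ) ^ (((l : ℂ) + 1) * (x : ℂ)) with hf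
  have hsq : Summable fun p : Nat.Primes => 1 / ((p : ℕ) : ℝ) ^ (2 : ℝ) :=
    (Real.summable_one_div_nat_rpow.2 one_lt_two).comp_injective Nat.Primes.coe_nat_injective
  have hbound : ∀ x : ℝ, 3 ≤ x → ∀ p : Nat.Primes,
      ‖f x p‖ ≤ 2 * C * (2 : ℝ) ^ (-(x - 5 / 2)) * (1 / ((p : ℕ) : ℝ) ^ (2 : ℝ)) := by
    intro x hx p
    have hp2 : (2 : ℝ) ≤ ((p : ℕ) : ℝ) := by exact_mod_cast p.2.two_le
    have hp0 : (0 : ℝ) < ((p : ℕ) : ℝ) := by linarith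
    set q : ℝ := ((p : ℕ) : ℝ) ^ (-(x - 1 / 2)) with hq
    have hq0 : 0 < q := by positivity
    have hq2 : q ≤ (2 : ℝ) ^ (-(x - 5 / 2)) * (1 / ((p : ℕ) : ℝ) ^ (2 : ℝ)) := by
      have e : -(x - 1 / 2) = -(x - 5 / 2) + -2 := by ring
      rw [hq, e, Real.rpow_add hp0, one_div, ← Real.rpow_neg hp0.le]
      exact mul_le_mul_of_nonneg_right
        (Real.rpow_le_rpow_of_nonpos (by norm_num) hp2 (by linarith)) (by positivity)
    have hqhalf : q ≤ 1 / 2 := by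
      refine hq2.trans ?_
      have h1 : (2 : ℝ) ^ (-(x - 5 / 2)) ≤ 1 :=
        Real.rpow_le_one_of_one_le_of_nonpos (by norm_num) (by linarith)
      have h2 : 1 / ((p : ℕ) : ℝ) ^ (2 : ℝ) ≤ 1 / 2 := by
        apply one_div_le_one_div_of_le (by norm_num)
        rw [Real.rpow_two]; nlinarith
      calc _ ≤ 1 * (1 / 2 : ℝ) := by gcongr
        _ = _ := by norm_num
    have hgeom : HasSum (fun l : ℕ => C * (q * q ^ l)) (C * (q * (1 - q)⁻¹)) :=
      ((hasSum_geometric_of_lt_one hq0.le (by linarith)).mul_left q).mul_left C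
    refine (tsum_of_norm_bounded hgeom fun l => ?_).trans ?_
    · have h1 := hb p (l + 1) p.2 (by omega)
      rw [norm_div, Complex.norm_natCast_cpow_of_pos p.2.pos]
      have hre : (((l : ℂ) + 1) * (x : ℂ)).re = (l + 1) * x := by simp
      rw [hre, div_le_iff₀ (by positivity)]
      refine h1.trans ?_
      rw [mul_assoc]
      gcongr
      have e : q * q ^ l = ((p : ℕ) : ℝ) ^ (-(x - 1 / 2) * (l + 1)) := by
        rw [← pow_succ', ← Real.rpow_natCast, hq, ← Real.rpow_mul hp0.le]; push_cast; ring_nf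
      rw [e, ← Real.rpow_add hp0]
      apply Real.rpow_le_rpow_of_exponent_le (by linarith)
      push_cast
      have : (0 : ℝ) ≤ (l : ℝ) + 1 := by positivity
      nlinarith
    · have h1 : (1 - q)⁻¹ ≤ 2 := by
        rw [inv_le_comm₀ (by linarith) (by norm_num)]; linarith
      calc C * (q * (1 - q)⁻¹) ≤ C * ((2 : ℝ) ^ (-(x - 5 / 2)) *
            (1 / ((p : ℕ) : ℝ) ^ (2 : ℝ)) * 2) :=
            mul_le_mul_of_nonneg_left (mul_le_mul hq2 h1 (inv_nonneg.2 (by linarith))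
              (by positivity)) hC
        _ = _ := by ring
  have hL : ∀ x : ℝ, 3 ≤ x → L.toFun x = Complex.exp (∑' p, f x p) := by
    intro x hx
    have hs : Summable (f x) := Summable.of_norm_bounded (hsq.mul_left _) (hbound x hx)
    exact (hprod x (by simp; linarith)).unique hs.hasSum.cexp
  have h0 : Tendsto (fun x : ℝ => ∑' p, f x p) atTop (𝓝 0) := by
    rw [tendsto_zero_iff_norm_tendsto_zero]
    have h : Tendsto (fun x : ℝ => (2 : ℝ) ^ (-(x - 5 / 2)) *
        (2 * C * ∑' p : Nat.Primes, 1 / ((p : ℕ) : ℝ) ^ (2 : ℝ))) atTop (𝓝 0) := by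
      have := (tendsto_two_rpow_neg.comp (tendsto_atTop_add_const_right atTop (-(5 / 2))
        tendsto_id)).mul_const (2 * C * ∑' p : Nat.Primes, 1 / ((p : ℕ) : ℝ) ^ (2 : ℝ))
      simpa [Function.comp_def, sub_eq_add_neg] using this
    refine squeeze_zero' (Eventually.of_forall fun _ => norm_nonneg _) ?_ h
    filter_upwards [eventually_ge_atTop 3] with x hx
    have := tsum_of_norm_bounded (hsq.mul_left _).hasSum (hbound x hx)
    rw [tsum_mul_left] at this
    linarith
  have h1 := (Complex.continuous_exp.tendsto 0).comp h0
  rw [Complex.exp_zero] at h1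
  refine h1.congr' ?_
  filter_upwards [eventually_ge_atTop 3] with x hx
  exact (hL x hx).symm

lemma coeff_one {a₁ : ℝ} (ha₁ : ∀ n : ℕ, 1 ≤ n → ‖L.coeff n‖ ≤ a₁ * n) : L.coeff 1 = 1 := by
  have h := L.tendsto_toFun_coeff_one ha₁ (a := 3) (by norm_num) 0
  simp only [Complex.ofReal_zero, zero_mul, add_zero] at h
  exact tendsto_nhds_unique h L.tendsto_toFun_one

lemma one_le_coeff_bound {a₁ : ℝ} (ha₁ : ∀ n : ℕ, 1 ≤ n → ‖L.coeff n‖ ≤ a₁ * n) : 1 ≤ a₁ := by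
  simpa [L.coeff_one ha₁] using ha₁ 1 le_rfl

lemma norm_toFun_sub_one_lt {a₁ a : ℝ} (ha₁ : ∀ n : ℕ, 1 ≤ n → ‖L.coeff n‖ ≤ a₁ * n)
    (ha : 2 < a) (ha_sum : ∑' n : ℕ, a₁ / ((n : ℝ) + 2) ^ a < 1 / 2) {s : ℂ}
    (hs : a + 1 ≤ s.re) : ‖L.toFun s - 1‖ < 1 / 2 := by
  have h := L.norm_toFun_sub_coeff_one_le ha₁ ha (r := 0) le_rfl (by linarith : a + 1 + 0 ≤ s.re)
  rw [L.coeff_one ha₁] at h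
  simp only [neg_zero, Real.rpow_zero, mul_one] at h
  linarith

end SelbergFunction

/-! ### Counting zeros by Jensen's formula -/

lemma circleMap_sub_half_pi_re (c : ℂ) (r θ : ℝ) :
    (circleMap c r (θ + -(Real.pi / 2))).re = c.re + r * Real.sin θ := by
  rw [circleMap, Complex.add_re, Complex.re_ofReal_mul,
    Complex.exp_ofReal_mul_I_re, ← sub_eq_add_neg, Real.cos_sub_pi_div_two]

/-- A function which is at most `A` on the right half of a circle and at most `B` on its left half
has average at most `(A + B) / 2`. -/
lemma circleAverage_le_of_half {f : ℂ → ℝ} {c : ℂ} {r A B : ℝ} (hr : 0 ≤ r)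
    (hf : CircleIntegrable f c r)
    (hA : ∀ z ∈ Metric.sphere c r, c.re ≤ z.re → f z ≤ A)
    (hB : ∀ z ∈ Metric.sphere c r, z.re ≤ c.re → f z ≤ B) :
    Real.circleAverage f c r ≤ (A + B) / 2 := by
  rw [Real.circleAverage_eq_integral_add (-(Real.pi / 2))]
  set g : ℝ → ℝ := fun θ => f (circleMap c r (θ + -(Real.pi / 2))) with hg
  have hpi := Real.pi_pos
  have hper : Function.Periodic (fun θ => f (circleMap c r θ)) (2 * Real.pi) := fun x => by
    simp [periodic_circleMap c r x]
  have hint0 : ∀ u v : ℝ, IntervalIntegrable (fun θ => f (circleMap c r θ)) volume u v :=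
    hper.intervalIntegrable₀ (by positivity) hf
  have hint : ∀ u v : ℝ, IntervalIntegrable g volume u v := fun u v => by
    have := (hint0 (u + -(Real.pi / 2)) (v + -(Real.pi / 2))).comp_add_right (-(Real.pi / 2))
    simpa using this
  have h1 : ∫ θ in (0 : ℝ)..Real.pi, g θ ≤ Real.pi * A := by
    have := intervalIntegral.integral_mono_on hpi.le (hint 0 Real.pi)
      (intervalIntegrable_const (c := A)) fun θ hθ => hA _ (circleMap_mem_sphere c hr _) (by
        rw [circleMap_sub_half_pi_re]
        have := mul_nonneg hr (Real.sin_nonneg_of_nonneg_of_le_pi hθ.1 hθ.2)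
        linarith)
    simpa using this
  have h2 : ∫ θ in Real.pi..(2 * Real.pi), g θ ≤ Real.pi * B := by
    have := intervalIntegral.integral_mono_on (by linarith) (hint Real.pi (2 * Real.pi))
      (intervalIntegrable_const (c := B)) fun θ hθ => hB _ (circleMap_mem_sphere c hr _) (by
        rw [circleMap_sub_half_pi_re]
        have h3 : Real.sin θ ≤ 0 := by
          rw [← Real.sin_sub_two_pi]
          exact Real.sin_nonpos_of_nonpos_of_neg_pi_le (by linarith [hθ.2]) (by linarith [hθ.1])
        have := mul_nonpos_of_nonneg_of_nonpos hr h3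
        linarith)
    have e : 2 * Real.pi - Real.pi = Real.pi := by ring
    simpa [e] using this
  rw [← intervalIntegral.integral_add_adjacent_intervals (hint 0 Real.pi) (hint _ _), smul_eq_mul]
  calc _ ≤ (2 * Real.pi)⁻¹ * (Real.pi * A + Real.pi * B) := by gcongr
    _ = _ := by field_simp

lemma one_le_divisor_of_zero {f : ℂ → ℂ} {c : ℂ} {ρ : ℝ} (hρ : 0 < ρ)
    (hf : AnalyticOnNhd ℂ f (Metric.closedBall c ρ)) (hc : f c ≠ 0) {u : ℂ}
    (hu : u ∈ Metric.closedBall c ρ) (h0 : f u = 0) :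
    1 ≤ MeromorphicOn.divisor f (Metric.closedBall c ρ) u := by
  have htop : analyticOrderAt f u ≠ ⊤ := fun h => by
    rw [analyticOrderAt_eq_top] at h
    exact hc (hf.eqOn_zero_of_preconnected_of_eventuallyEq_zero
      (convex_closedBall c ρ).isPreconnected hu h (Metric.mem_closedBall_self hρ.le))
  have hne : analyticOrderAt f u ≠ 0 := fun h => (hf u hu).analyticOrderAt_eq_zero.1 h h0
  obtain ⟨n, hn⟩ := ENat.ne_top_iff_exists.1 htop
  rw [MeromorphicOn.AnalyticOnNhd.divisor_apply hf hu, ← hn]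
  rw [← hn] at hne
  have : n ≠ 0 := by simpa using hne
  simp
  omega

/-- An inequality form of Jensen's formula, for any finite set of distinct zeros. -/
lemma card_zeros_mul_log_le {f : ℂ → ℂ} {c : ℂ} {r ρ : ℝ} (hr : 0 < r) (hrρ : r < ρ)
    (hf : AnalyticOnNhd ℂ f (Metric.closedBall c ρ)) (hc : f c ≠ 0) (Z : Finset ℂ)
    (hZ : ∀ u ∈ Z, ‖c - u‖ ≤ r ∧ f u = 0) :
    Z.card * Real.log (ρ / r) ≤
      Real.circleAverage (fun z => Real.log ‖f z‖) c ρ - Real.log ‖f c‖ := by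
  have hρ : 0 < ρ := hr.trans hrρ
  have habs : |ρ| = ρ := abs_of_pos hρ
  have hJ := AnalyticOnNhd.circleAverage_log_norm hρ.ne' (by rwa [habs]) hc
  rw [habs] at hJ
  rw [hJ, add_sub_cancel_right]
  set D := MeromorphicOn.divisor f (Metric.closedBall c ρ) with hD
  have hfin : (Function.support fun u => (D u : ℝ) * Real.log (ρ * ‖c - u‖⁻¹)).Finite := by
    refine (D.finiteSupport (isCompact_closedBall c ρ)).subset fun u hu => ?_
    simp only [Function.mem_support] at hu ⊢
    exact fun h => hu (by simp [h])
  have hDnn : ∀ u, 0 ≤ D u := fun u => MeromorphicOn.AnalyticOnNhd.divisor_nonneg hf u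
  have hnn : ∀ u, 0 ≤ (D u : ℝ) * Real.log (ρ * ‖c - u‖⁻¹) := by
    intro u
    by_cases hu : u ∈ Metric.closedBall c ρ
    · refine mul_nonneg (by exact_mod_cast hDnn u) ?_
      rcases eq_or_ne (‖c - u‖) 0 with h | h
      · simp [h]
      · apply Real.log_nonneg
        rw [← div_eq_mul_inv, one_le_div (lt_of_le_of_ne (norm_nonneg _) h.symm)]
        rwa [mem_closedBall_iff_norm'] at hu
    · simp [hD, hu]
  classical
  rw [finsum_eq_sum_of_support_subset (s := hfin.toFinset ∪ Z) _ (by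
    intro u hu; simp only [Finset.coe_union, Set.Finite.coe_toFinset]; exact Or.inl hu)]
  refine le_trans ?_ (Finset.sum_le_sum_of_subset_of_nonneg Finset.subset_union_right
    fun u _ _ => hnn u)
  rw [← nsmul_eq_mul]
  refine Finset.card_nsmul_le_sum _ _ _ fun u hu => ?_
  obtain ⟨h1, h2⟩ := hZ u hu
  have hne : 0 < ‖c - u‖ := by
    rw [norm_pos_iff, sub_ne_zero]
    rintro rfl
    exact hc h2
  have hdiv : (1 : ℝ) ≤ D u := by
    exact_mod_cast one_le_divisor_of_zero hρ hf hc
      (mem_closedBall_iff_norm'.2 (h1.trans hrρ.le)) h2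
  have hlog : Real.log (ρ / r) ≤ Real.log (ρ * ‖c - u‖⁻¹) := by
    rw [← div_eq_mul_inv]
    exact Real.log_le_log (by positivity) (by gcongr)
  have hlog0 : 0 ≤ Real.log (ρ / r) := Real.log_nonneg ((one_le_div hr).2 hrρ.le)
  nlinarith

/-- Counting zeros of `Re F` on the real axis: they are zeros of the holomorphic function
`z ↦ (F(z) + conj (F(conj z))) / 2`, whose modulus on the circle is controlled by that of `F`. -/
lemma card_re_zeros_mul_log_le {F : ℂ → ℂ} {c r ρ A B : ℝ} (hr : 0 < r) (hrρ : r < ρ)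
    (hF : ∀ z ∈ Metric.closedBall (c : ℂ) ρ, AnalyticAt ℂ F z) (hc : 1 / 2 ≤ (F c).re)
    (hA0 : 0 ≤ A) (hB0 : 0 ≤ B)
    (hA : ∀ z ∈ Metric.sphere (c : ℂ) ρ, c ≤ z.re → ‖F z‖ ≤ Real.exp A)
    (hB : ∀ z ∈ Metric.sphere (c : ℂ) ρ, z.re ≤ c → ‖F z‖ ≤ Real.exp B)
    (Z : Finset ℝ) (hZ : ∀ x ∈ Z, |c - x| ≤ r ∧ (F x).re = 0) :
    Z.card * Real.log (ρ / r) ≤ (A + B) / 2 + Real.log 2 := by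
  have hρ : 0 < ρ := hr.trans hrρ
  set g : ℂ → ℂ := fun z => (F z + conj (F (conj z))) / 2 with hg
  have hgre : ∀ x : ℝ, g x = ((F x).re : ℂ) := fun x => by
    simp only [hg, Complex.conj_ofReal, Complex.add_conj]
    push_cast; ring
  have hconjball : ∀ z ∈ Metric.closedBall (c : ℂ) ρ, conj z ∈ Metric.closedBall (c : ℂ) ρ := by
    intro z hz
    rw [Metric.mem_closedBall] at hz ⊢
    rwa [← Complex.conj_ofReal, Complex.dist_conj_conj]
  have hconjsph : ∀ z ∈ Metric.sphere (c : ℂ) ρ, conj z ∈ Metric.sphere (c : ℂ) ρ := by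
    intro z hz
    rw [Metric.mem_sphere] at hz ⊢
    rwa [← Complex.conj_ofReal, Complex.dist_conj_conj]
  have hgan : AnalyticOnNhd ℂ g (Metric.closedBall (c : ℂ) ρ) := by
    intro z hz
    have h2 : AnalyticAt ℂ (fun z => conj (F (conj z))) z := by
      rw [Complex.analyticAt_iff_eventually_differentiableAt]
      have h3 := (hF _ (hconjball z hz)).eventually_analyticAt
      have h4 : Tendsto (fun z : ℂ => conj z) (𝓝 z) (𝓝 (conj z)) :=
        Complex.continuous_conj.continuousAt
      filter_upwards [h4.eventually h3] with w hw
      have h5 := hw.differentiableAt.conj_conj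
      simpa [Function.comp_def] using h5
    exact ((hF z hz).add h2).div_const
  have hgc : g c ≠ 0 := by
    rw [hgre]
    exact_mod_cast (by linarith : (0 : ℝ) < (F c).re).ne'
  have hbound : ∀ z M, ‖F z‖ ≤ Real.exp M → ‖F (conj z)‖ ≤ Real.exp M → 0 ≤ M →
      Real.log ‖g z‖ ≤ M := by
    intro z M h1 h2 hM
    rcases eq_or_ne (‖g z‖) 0 with h | h
    · rw [h, Real.log_zero]; exact hM
    · rw [Real.log_le_iff_le_exp (lt_of_le_of_ne (norm_nonneg _) h.symm)]
      have h3 : ‖g z‖ ≤ (‖F z‖ + ‖F (conj z)‖) / 2 := by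
        simp only [hg, norm_div, Complex.norm_ofNat]
        gcongr
        refine (norm_add_le _ _).trans ?_
        rw [RCLike.norm_conj]
      linarith
  have havg : Real.circleAverage (fun z => Real.log ‖g z‖) c ρ ≤ (A + B) / 2 := by
    refine circleAverage_le_of_half hρ.le ?_ ?_ ?_
    · refine MeromorphicOn.circleIntegrable_log_norm ?_
      rw [abs_of_pos hρ]
      exact fun z hz => (hgan z (Metric.sphere_subset_closedBall hz)).meromorphicAt
    · intro z hz hre
      exact hbound z A (hA z hz hre) (hA _ (hconjsph z hz) (by simpa using hre)) hA0
    · intro z hz hre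
      exact hbound z B (hB z hz hre) (hB _ (hconjsph z hz) (by simpa using hre)) hB0
  have hmap : (Z.map ⟨((↑) : ℝ → ℂ), Complex.ofReal_injective⟩).card = Z.card := Finset.card_map _
  have hJ := card_zeros_mul_log_le hr hrρ hgan hgc
    (Z.map ⟨((↑) : ℝ → ℂ), Complex.ofReal_injective⟩) (by
      intro u hu
      obtain ⟨x, hx, rfl⟩ := Finset.mem_map.1 hu
      obtain ⟨h1, h2⟩ := hZ x hx
      simp only [Function.Embedding.coeFn_mk]
      refine ⟨?_, by rw [hgre, h2, Complex.ofReal_zero]⟩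
      rwa [← Complex.ofReal_sub, Complex.norm_real, Real.norm_eq_abs])
  rw [hmap] at hJ
  have hlogc : -Real.log ‖g c‖ ≤ Real.log 2 := by
    rw [hgre, Complex.norm_real, Real.norm_eq_abs, abs_of_pos (by linarith), ← Real.log_inv]
    apply Real.log_le_log (by have : 0 < (F c).re := by linarith
                              positivity)
    rw [inv_le_comm₀ (by linarith) (by norm_num)]
    linarith
  linarith

/-! ### Bounds from the functional equation and the Phragmén–Lindelöf principle -/

lemma norm_add_nonneg_le {z : ℂ} (hz : 0 ≤ z.re) {D : ℝ} (hD : 0 ≤ D) :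
    ‖z‖ + D ≤ 3 / 2 * ‖z + D‖ := by
  have h1 : ‖z‖ ^ 2 = z.re ^ 2 + z.im ^ 2 := by
    rw [Complex.norm_eq_sqrt_sq_add_sq, Real.sq_sqrt (by positivity)]
  have h2 : ‖z + D‖ ^ 2 = (z.re + D) ^ 2 + z.im ^ 2 := by
    rw [Complex.norm_eq_sqrt_sq_add_sq, Real.sq_sqrt (by positivity)]
    simp
  refine abs_le_of_sq_le_sq' ?_ (by positivity) |>.2
  have h3 := mul_nonneg hz hD
  have h4 := sq_nonneg (‖z‖ - D)
  have h5 := sq_nonneg ‖z + D‖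
  nlinarith

namespace SelbergFunction

variable (L : SelbergFunction)

lemma differentiableAt_toFun {s : ℂ} (hs : s ≠ 1) : DifferentiableAt ℂ L.toFun s := by
  obtain ⟨G, ⟨hG, -⟩, hLG⟩ := L.continuation
  have h : DifferentiableAt ℂ (fun z => G z / (z - 1) ^ L.k) s := by
    refine (hG s).div (by fun_prop) (pow_ne_zero _ (sub_ne_zero.2 hs))
  refine h.congr_of_eventuallyEq ?_
  filter_upwards [isOpen_ne.mem_nhds hs] with z hz
  rw [← hLG z hz, mul_div_cancel_left₀ _ (pow_ne_zero _ (sub_ne_zero.2 hz))]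

lemma analyticAt_toFun {s : ℂ} (hs : s ≠ 1) : AnalyticAt ℂ L.toFun s := by
  rw [Complex.analyticAt_iff_eventually_differentiableAt]
  filter_upwards [isOpen_ne.mem_nhds hs] with z hz using L.differentiableAt_toFun hz

lemma norm_toFun_le_of_re_le_neg_two {a₁ : ℝ} (ha₁ : ∀ n : ℕ, 1 ≤ n → ‖L.coeff n‖ ≤ a₁ * n)
    {s : ℂ} (hs : s.re ≤ -2)
    (hpole : ∀ (j : Fin L.f) (n : ℕ), (L.lam j : ℂ) * s + L.mu j ≠ -(n : ℂ)) :
    ‖L.toFun s‖ ≤ a₁ * Real.pi ^ 2 / 6 * (L.Q ^ (1 - 2 * s.re) *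
      ∏ j, (Real.exp 1 * ‖(L.lam j : ℂ) * (1 - conj s) + L.mu j + 2‖) ^
        (L.lam j * (1 - 2 * s.re))) := by
  have hre : ∀ j, 0 < ((L.lam j : ℂ) * (1 - conj s) + L.mu j).re := fun j => by
    have h1 := L.lam_pos j
    have h2 := L.mu_re_nonneg j
    simp
    nlinarith
  have hs0 : s ≠ 0 := fun h => by simp [h] at hs; linarith
  have hs1 : s ≠ 1 := fun h => by simp [h] at hs; linarith
  have hfe := congrArg norm (L.functional_equation s hs0 hs1 hpole fun j n h => by
    have := hre j
    rw [h] at this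
    simp at this
    linarith [(n.cast_nonneg : (0 : ℝ) ≤ n)])
  simp only [norm_mul, norm_prod, RCLike.norm_conj, L.norm_omega, one_mul,
    Complex.norm_cpow_eq_rpow_re_of_pos L.Q_pos] at hfe
  have hG : ∀ j, 0 < ‖Complex.Gamma ((L.lam j : ℂ) * s + L.mu j)‖ := fun j =>
    norm_pos_iff.2 (Complex.Gamma_ne_zero (hpole j))
  have hgamma : ∀ j, ‖Complex.Gamma ((L.lam j : ℂ) * (1 - conj s) + L.mu j)‖ ≤
      ‖Complex.Gamma ((L.lam j : ℂ) * s + L.mu j)‖ *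
        (Real.exp 1 * ‖(L.lam j : ℂ) * (1 - conj s) + L.mu j + 2‖) ^
          (L.lam j * (1 - 2 * s.re)) := by
    intro j
    have h1 := L.lam_pos j
    have h2 := L.mu_re_nonneg j
    have e : (L.lam j : ℂ) * s + L.mu j + ((L.lam j * (1 - 2 * s.re) : ℝ) : ℂ) =
        (L.lam j : ℂ) * (1 - conj s) + L.mu j := by
      apply Complex.ext
      · simp; ring
      · simp
    have h := norm_Gamma_add_real_le (z := (L.lam j : ℂ) * s + L.mu j)
      (δ := L.lam j * (1 - 2 * s.re)) (by nlinarith) (by simp; nlinarith) (by simp; nlinarith)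
      (hpole j)
    rwa [e] at h
  have hprod : ∏ j, ‖Complex.Gamma ((L.lam j : ℂ) * (1 - conj s) + L.mu j)‖ ≤
      (∏ j, ‖Complex.Gamma ((L.lam j : ℂ) * s + L.mu j)‖) *
        ∏ j, (Real.exp 1 * ‖(L.lam j : ℂ) * (1 - conj s) + L.mu j + 2‖) ^
          (L.lam j * (1 - 2 * s.re)) := by
    rw [← Finset.prod_mul_distrib]
    exact Finset.prod_le_prod (fun j _ => norm_nonneg _) fun j _ => hgamma j
  have hL := L.norm_toFun_le_of_three_le_re ha₁ (s := 1 - conj s) (by simp; linarith)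
  set P := ∏ j, ‖Complex.Gamma ((L.lam j : ℂ) * s + L.mu j)‖ with hP
  have hP0 : 0 < P := Finset.prod_pos fun j _ => hG j
  have hQ : (1 - conj s).re = (1 - 2 * s.re) + s.re := by simp; ring
  rw [hQ, Real.rpow_add L.Q_pos] at hfe
  have hQs : 0 < L.Q ^ s.re := Real.rpow_pos_of_pos L.Q_pos _
  have hQ2 : 0 < L.Q ^ (1 - 2 * s.re) := Real.rpow_pos_of_pos L.Q_pos _
  have hA : 0 ≤ a₁ * Real.pi ^ 2 / 6 := (norm_nonneg _).trans hL
  set W := ∏ j, (Real.exp 1 * ‖(L.lam j : ℂ) * (1 - conj s) + L.mu j + 2‖) ^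
          (L.lam j * (1 - 2 * s.re)) with hW
  refine le_of_mul_le_mul_right ?_ (mul_pos hQs hP0)
  calc ‖L.toFun s‖ * (L.Q ^ s.re * P) = ‖L.toFun s‖ * L.Q ^ s.re * P := by ring
    _ = _ := hfe
    _ ≤ (a₁ * Real.pi ^ 2 / 6) * (L.Q ^ (1 - 2 * s.re) * L.Q ^ s.re) * (P * W) := by
        gcongr
    _ = _ := by ring

/-- The majorant `(s + 5)^k ∏ (s + 5 + D_j) ^ (5 λ_j)` of the Phragmén–Lindelöf argument, holomorphic
for `Re s ≥ -2`. Its modulus dominates `(s - 1)^k L(s)`, up to a constant, on both edges of the strip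
`-2 ≤ Re s ≤ 3`; the exponent `5 λ_j` is the one needed on the left edge. -/
noncomputable def comparison (D : Fin L.f → ℝ) (s : ℂ) : ℂ :=
  (s + 5) ^ L.k * ∏ j, (s + 5 + D j) ^ ((5 * L.lam j : ℝ) : ℂ)

lemma norm_comparison {D : Fin L.f → ℝ} (hD : ∀ j, 0 ≤ D j) {s : ℂ} (hs : -2 ≤ s.re) :
    ‖L.comparison D s‖ = ‖s + 5‖ ^ L.k * ∏ j, ‖s + 5 + D j‖ ^ (5 * L.lam j) := by
  rw [comparison, norm_mul, norm_pow, norm_prod]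
  congr 1
  refine Finset.prod_congr rfl fun j _ => ?_
  have h0 : s + 5 + D j ≠ 0 := fun h => by
    have := congrArg Complex.re h
    have hDj := hD j
    simp at this
    linarith
  rw [Complex.norm_cpow_of_ne_zero h0]
  simp

lemma one_le_norm_add {D : ℝ} (hD : 0 ≤ D) {s : ℂ} (hs : -2 ≤ s.re) : 1 ≤ ‖s + 5 + D‖ := by
  refine le_trans ?_ (Complex.re_le_norm _)
  simp
  linarith

lemma one_le_prod_norm_add_rpow {D : Fin L.f → ℝ} (hD : ∀ j, 0 ≤ D j) {s : ℂ}
    (hs : -2 ≤ s.re) : 1 ≤ ∏ j, ‖s + 5 + D j‖ ^ (5 * L.lam j) := by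
  calc (1 : ℝ) = ∏ _j : Fin L.f, 1 := by simp
    _ ≤ _ := Finset.prod_le_prod (fun _ _ => zero_le_one) fun j _ =>
      Real.one_le_rpow (one_le_norm_add (hD j) hs) (by have := L.lam_pos j; positivity)

lemma one_le_norm_comparison {D : Fin L.f → ℝ} (hD : ∀ j, 0 ≤ D j) {s : ℂ} (hs : -2 ≤ s.re) :
    1 ≤ ‖L.comparison D s‖ := by
  rw [L.norm_comparison hD hs]
  have h0 := one_le_norm_add le_rfl hs
  simp only [Complex.ofReal_zero, add_zero] at h0
  exact one_le_mul_of_one_le_of_one_le (one_le_pow₀ h0) (L.one_le_prod_norm_add_rpow hD hs)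

lemma differentiableAt_comparison {D : Fin L.f → ℝ} (hD : ∀ j, 0 ≤ D j) {s : ℂ}
    (hs : -2 ≤ s.re) : DifferentiableAt ℂ (L.comparison D) s := by
  unfold comparison
  refine DifferentiableAt.mul (by fun_prop) ?_
  refine DifferentiableAt.fun_finsetProd fun j _ => ?_
  refine DifferentiableAt.cpow_const (by fun_prop) (Or.inl ?_)
  have := hD j
  simp
  linarith

/-- On the line `Re s = -2`, away from the ordinates at which the functional equation may involve
a pole of a Gamma factor. -/
lemma norm_le_comparison_of_re_eq_neg_two {a₁ τ : ℝ}
    (ha₁ : ∀ n : ℕ, 1 ≤ n → ‖L.coeff n‖ ≤ a₁ * n) (hτ : 0 ≤ τ)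
    (hμ : ∀ j, ‖L.mu j‖ ≤ L.lam j * (τ / 2)) {s : ℂ} (hs : s.re = -2)
    (him : ∀ j, L.lam j * s.im + (L.mu j).im ≠ 0) :
    ‖(s - 1) ^ L.k * L.toFun s‖ ≤ a₁ * Real.pi ^ 2 / 6 *
      (L.Q ^ (5 : ℝ) * ∏ j, (Real.exp 1 * (3 / 2 * L.lam j)) ^ (5 * L.lam j)) *
        ‖L.comparison (fun j => τ / 2 + 2 / L.lam j) s‖ := by
  have hlam := L.lam_pos
  have hD : ∀ j, 0 ≤ τ / 2 + 2 / L.lam j := fun j => by have := hlam j; positivity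
  have h := L.norm_toFun_le_of_re_le_neg_two ha₁ hs.le fun j n h => him j (by
    have := congrArg Complex.im h
    simpa using this)
  have e5 : 1 - 2 * s.re = 5 := by rw [hs]; norm_num
  rw [e5] at h
  have hterm : ∀ j, (Real.exp 1 * ‖(L.lam j : ℂ) * (1 - conj s) + L.mu j + 2‖) ^ (L.lam j * 5) ≤
      (Real.exp 1 * (3 / 2 * L.lam j)) ^ (5 * L.lam j) *
        ‖s + 5 + ((τ / 2 + 2 / L.lam j : ℝ) : ℂ)‖ ^ (5 * L.lam j) := by
    intro j
    have hj := hlam j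
    rw [← Real.mul_rpow (by positivity) (by positivity), mul_comm (L.lam j) 5]
    refine Real.rpow_le_rpow (by positivity) ?_ (by positivity)
    rw [mul_assoc]
    refine mul_le_mul_of_nonneg_left ?_ (Real.exp_pos 1).le
    have e1 : 1 - conj s = s + 5 := by
      apply Complex.ext <;> simp [hs]; norm_num
    rw [e1]
    have h2 := norm_add_nonneg_le (z := s + 5) (by simp [hs]; norm_num) (hD j)
    calc ‖(L.lam j : ℂ) * (s + 5) + L.mu j + 2‖
        ≤ ‖(L.lam j : ℂ) * (s + 5)‖ + ‖L.mu j‖ + ‖(2 : ℂ)‖ := norm_add₃_le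
      _ ≤ L.lam j * ‖s + 5‖ + L.lam j * (τ / 2) + 2 := by
          rw [norm_mul, Complex.norm_real, Real.norm_of_nonneg hj.le, Complex.norm_ofNat]
          gcongr
          exact hμ j
      _ = L.lam j * (‖s + 5‖ + (τ / 2 + 2 / L.lam j)) := by field_simp; ring
      _ ≤ L.lam j * (3 / 2 * ‖s + 5 + ((τ / 2 + 2 / L.lam j : ℝ) : ℂ)‖) := by gcongr
      _ = _ := by ring
  have hprod : ∏ j, (Real.exp 1 * ‖(L.lam j : ℂ) * (1 - conj s) + L.mu j + 2‖) ^ (L.lam j * 5) ≤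
      (∏ j, (Real.exp 1 * (3 / 2 * L.lam j)) ^ (5 * L.lam j)) *
        ∏ j, ‖s + 5 + ((τ / 2 + 2 / L.lam j : ℝ) : ℂ)‖ ^ (5 * L.lam j) := by
    rw [← Finset.prod_mul_distrib]
    exact Finset.prod_le_prod (fun j _ => by positivity) fun j _ => hterm j
  have hk : ‖s - 1‖ ≤ ‖s + 5‖ := by
    rw [Complex.norm_eq_sqrt_sq_add_sq, Complex.norm_eq_sqrt_sq_add_sq]
    apply Real.sqrt_le_sqrt
    simp [hs]; norm_num
  have hA : 0 ≤ a₁ * Real.pi ^ 2 / 6 := by have := L.coeff_bound_nonneg ha₁; positivity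
  have hQ5 : 0 ≤ L.Q ^ (5 : ℝ) := Real.rpow_nonneg L.Q_pos.le _
  rw [L.norm_comparison hD (by rw [hs]), norm_mul, norm_pow]
  calc _ ≤ ‖s + 5‖ ^ L.k * (a₁ * Real.pi ^ 2 / 6 * (L.Q ^ (5 : ℝ) *
        ((∏ j, (Real.exp 1 * (3 / 2 * L.lam j)) ^ (5 * L.lam j)) *
        ∏ j, ‖s + 5 + ((τ / 2 + 2 / L.lam j : ℝ) : ℂ)‖ ^ (5 * L.lam j)))) := by
        gcongr
        exact h.trans (by gcongr)
    _ = _ := by ring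

lemma eventually_rpow_le_exp (A : ℝ) :
    ∃ B : ℝ, ∀ᶠ x : ℝ in atTop, ∀ r : ℝ, x ≤ r → r ≤ 2 * x →
      r ^ A ≤ B * Real.exp (1 / 2 * x) := by
  refine ⟨2 ^ |A|, ?_⟩
  have h := (isLittleO_rpow_exp_pos_mul_atTop |A| (by norm_num : (0 : ℝ) < 1 / 2)).bound one_pos
  filter_upwards [h, eventually_ge_atTop 1] with x hx hx1 r hr1 hr2
  rw [Real.norm_of_nonneg (by positivity), Real.norm_of_nonneg (by positivity), one_mul] at hx
  calc r ^ A ≤ r ^ |A| := Real.rpow_le_rpow_of_exponent_le (by linarith) (le_abs_self A)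
    _ ≤ (2 * x) ^ |A| := Real.rpow_le_rpow (by linarith) hr2 (abs_nonneg A)
    _ = 2 ^ |A| * x ^ |A| := Real.mul_rpow (by norm_num) (by linarith)
    _ ≤ _ := by gcongr

/-- The bound in the strip `-2 ≤ Re s ≤ 3`. -/
lemma norm_toFun_le_of_mem_strip {a₁ τ : ℝ}
    (ha₁ : ∀ n : ℕ, 1 ≤ n → ‖L.coeff n‖ ≤ a₁ * n) (hτ : 0 ≤ τ)
    (hμ : ∀ j, ‖L.mu j‖ ≤ L.lam j * (τ / 2)) {s : ℂ} (hs : -2 ≤ s.re) (hs' : s.re ≤ 3)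
    (him : 2 ≤ s.im) :
    ‖L.toFun s‖ ≤ a₁ * Real.pi ^ 2 / 6 *
      max 1 (L.Q ^ (5 : ℝ) * ∏ j, (Real.exp 1 * (3 / 2 * L.lam j)) ^ (5 * L.lam j)) *
        (4 ^ L.k * ∏ j, ‖s + 5 + ((τ / 2 + 2 / L.lam j : ℝ) : ℂ)‖ ^ (5 * L.lam j)) := by
  have hlam := L.lam_pos
  set D : Fin L.f → ℝ := fun j => τ / 2 + 2 / L.lam j with hDdef
  have hD : ∀ j, 0 ≤ D j := fun j => by have := hlam j; simp only [hDdef]; positivity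
  have hA : 0 ≤ a₁ * Real.pi ^ 2 / 6 := by have := L.coeff_bound_nonneg ha₁; positivity
  obtain ⟨G, ⟨hG, A, C, hGA⟩, hLG⟩ := L.continuation
  set W := L.Q ^ (5 : ℝ) * ∏ j, (Real.exp 1 * (3 / 2 * L.lam j)) ^ (5 * L.lam j) with hW
  set M := a₁ * Real.pi ^ 2 / 6 * max 1 W with hM
  have hMW : a₁ * Real.pi ^ 2 / 6 * W ≤ M := mul_le_mul_of_nonneg_left (le_max_right _ _) hA
  have hM1 : a₁ * Real.pi ^ 2 / 6 ≤ M := by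
    have := mul_le_mul_of_nonneg_left (le_max_left 1 W) hA
    linarith
  set Φ : ℂ → ℂ := fun z => G z / L.comparison D z with hΦ
  have hΦd : ∀ z : ℂ, -2 ≤ z.re → DifferentiableAt ℂ Φ z := fun z hz =>
    (hG z).div (L.differentiableAt_comparison hD hz) fun h => by
      have := L.one_le_norm_comparison hD hz
      rw [h, norm_zero] at this
      linarith
  have hΦle : ∀ z : ℂ, -2 ≤ z.re → ∀ K, ‖G z‖ ≤ K * ‖L.comparison D z‖ → ‖Φ z‖ ≤ K := by
    intro z hz K hK
    have := L.one_le_norm_comparison hD hz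
    rw [hΦ, norm_div, div_le_iff₀ (by linarith)]
    exact hK
  -- the left edge of the strip: a finite set of ordinates is covered by continuity
  have hleft : ∀ z : ℂ, z.re = -2 → ‖Φ z‖ ≤ M := by
    have hcont : Continuous fun t : ℝ => ‖Φ (-2 + t * Complex.I)‖ := by
      rw [continuous_iff_continuousAt]
      intro t
      have h1 : ContinuousAt Φ (-2 + t * Complex.I) := (hΦd _ (by simp)).continuousAt
      have h2 : ContinuousAt (fun t : ℝ => (-2 + t * Complex.I : ℂ)) t := by fun_prop
      exact (ContinuousAt.comp (f := fun t : ℝ => (-2 + t * Complex.I : ℂ)) h1 h2).norm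
    have hfin : (⋃ j, {t : ℝ | L.lam j * t + (L.mu j).im = 0}).Finite := by
      refine Set.finite_iUnion fun j => Set.Finite.subset (Set.finite_singleton
        (-(L.mu j).im / L.lam j)) fun t ht => ?_
      have := (hlam j).ne'
      rw [Set.mem_singleton_iff, eq_div_iff this]
      have h2 : L.lam j * t + (L.mu j).im = 0 := ht
      linarith
    have hdense := hfin.countable.dense_compl ℝ
    have hclosed : IsClosed {t : ℝ | ‖Φ (-2 + t * Complex.I)‖ ≤ M} :=
      isClosed_le hcont continuous_const
    have hsub : (⋃ j, {t : ℝ | L.lam j * t + (L.mu j).im = 0})ᶜ ⊆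
        {t : ℝ | ‖Φ (-2 + t * Complex.I)‖ ≤ M} := by
      intro t ht
      refine hΦle _ (by simp) _ ?_
      have hre : (-2 + t * Complex.I : ℂ).re = -2 := by simp
      have him : (-2 + t * Complex.I : ℂ).im = t := by simp
      have h := L.norm_le_comparison_of_re_eq_neg_two ha₁ hτ hμ hre fun j hj => ht (by
        rw [him] at hj
        exact Set.mem_iUnion.2 ⟨j, hj⟩)
      rw [hLG _ fun h => by rw [h] at hre; norm_num at hre] at h
      exact h.trans (mul_le_mul_of_nonneg_right hMW (norm_nonneg _))
    intro z hz
    have hall : z.im ∈ {t : ℝ | ‖Φ (-2 + t * Complex.I)‖ ≤ M} :=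
      hclosed.closure_subset_iff.2 hsub (hdense z.im)
    have e : z = -2 + z.im * Complex.I := by apply Complex.ext <;> simp [hz]
    rw [e]
    exact hall
  have hright : ∀ z : ℂ, z.re = 3 → ‖Φ z‖ ≤ M := by
    intro z hz
    refine hΦle _ (by linarith) _ ?_
    rw [← hLG z fun h => by rw [h] at hz; norm_num at hz, norm_mul, norm_pow,
      L.norm_comparison hD (by linarith)]
    have hk : ‖z - 1‖ ≤ ‖z + 5‖ := by
      rw [Complex.norm_eq_sqrt_sq_add_sq, Complex.norm_eq_sqrt_sq_add_sq]
      apply Real.sqrt_le_sqrt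
      simp [hz]; norm_num
    have h3 := (L.norm_toFun_le_of_three_le_re ha₁ hz.ge).trans hM1
    have h4 : 1 ≤ ∏ j, ‖z + 5 + D j‖ ^ (5 * L.lam j) :=
      L.one_le_prod_norm_add_rpow hD (by linarith)
    have hM0 : 0 ≤ M := hA.trans hM1
    calc ‖z - 1‖ ^ L.k * ‖L.toFun z‖ ≤ ‖z + 5‖ ^ L.k * M := by gcongr
      _ = M * (‖z + 5‖ ^ L.k * 1) := by ring
      _ ≤ _ := by gcongr
  have hgrowth : ∃ c < Real.pi / (3 - -2), ∃ B, Φ =O[comap (_root_.abs ∘ Complex.im) atTop ⊓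
      𝓟 (Complex.re ⁻¹' Set.Ioo (-2) 3)] fun z ↦ Real.exp (B * Real.exp (c * |z.im|)) := by
    obtain ⟨B, hB⟩ := eventually_rpow_le_exp A
    refine ⟨1 / 2, by have := Real.pi_gt_three; linarith, B, ?_⟩
    refine Asymptotics.IsBigO.of_bound |C| ?_
    rw [eventually_inf_principal]
    have hT : Tendsto (_root_.abs ∘ Complex.im) (comap (_root_.abs ∘ Complex.im) atTop) atTop :=
      tendsto_comap
    filter_upwards [hT.eventually hB, hT.eventually (eventually_ge_atTop 3)] with z hz1 hz2 hz3
    simp only [Function.comp_apply] at hz1 hz2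
    have hre : |z.re| ≤ 3 := abs_le.2 ⟨by linarith [hz3.1], hz3.2.le⟩
    have h1 := hz1 ‖z‖ (Complex.abs_im_le_norm z)
      ((Complex.norm_le_abs_re_add_abs_im z).trans (by linarith))
    rw [Real.norm_of_nonneg (Real.exp_pos _).le]
    have hz4 : -2 ≤ z.re := hz3.1.le
    refine hΦle z hz4 _ ?_
    have h2 := L.one_le_norm_comparison hD hz4
    calc ‖G z‖ ≤ C * Real.exp (‖z‖ ^ A) := hGA z
      _ ≤ |C| * Real.exp (B * Real.exp (1 / 2 * |z.im|)) := by
          gcongr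
          exact le_abs_self C
      _ ≤ _ := le_mul_of_one_le_right (by positivity) h2
  have hPL := PhragmenLindelof.vertical_strip (f := Φ) (a := -2) (b := 3) (C := M) ?_ hgrowth hleft
    hright hs hs'
  · have hc1 := L.one_le_norm_comparison hD hs
    rw [hΦ, norm_div, div_le_iff₀ (by linarith), L.norm_comparison hD hs,
      ← hLG s fun h => by rw [h] at him; norm_num at him, norm_mul, norm_pow] at hPL
    have hs1 : 2 ≤ ‖s - 1‖ := by
      refine him.trans ((le_abs_self _).trans ?_)
      have := Complex.abs_im_le_norm (s - 1)
      simpa using this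
    have h4 : ‖s + 5‖ ≤ 4 * ‖s - 1‖ := by
      have e : s + 5 = (s - 1) + 6 := by ring
      rw [e]
      refine (norm_add_le _ _).trans ?_
      rw [Complex.norm_ofNat]
      linarith
    have hp : 0 < ‖s - 1‖ ^ L.k := by positivity
    have hM0 : 0 ≤ M := hA.trans hM1
    refine le_of_mul_le_mul_left ?_ hp
    calc ‖s - 1‖ ^ L.k * ‖L.toFun s‖
        ≤ M * (‖s + 5‖ ^ L.k * ∏ j, ‖s + 5 + D j‖ ^ (5 * L.lam j)) := hPL
      _ ≤ M * ((4 * ‖s - 1‖) ^ L.k * ∏ j, ‖s + 5 + D j‖ ^ (5 * L.lam j)) := by gcongr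
      _ = _ := by rw [mul_pow]; ring
  · refine DifferentiableOn.diffContOnCl fun z hz => (hΦd z ?_).differentiableWithinAt
    have hcl : IsClosed {z : ℂ | -2 ≤ z.re} := isClosed_le continuous_const Complex.continuous_re
    exact closure_minimal (fun w hw => hw.1.le) hcl hz

end SelbergFunction

/-! ### The bound on the left half of the circle -/

/-- The loss caused by the shift of the Gamma arguments: it is linear in `δ` unless `u` is small,
in which case `δ ≤ 2u` is small too. -/
lemma mul_log_add_inv_le {u δ : ℝ} (hu : 0 < u) (hδ : 0 ≤ δ) (hδu : δ ≤ 2 * u) :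
    δ * Real.log (13 / 10 + 1 / u) ≤ 2 * δ + 1 / (6 * u) := by
  have he : 2.7182818283 < Real.exp 1 := Real.exp_one_gt_d9
  have hx : 0 < 13 / 10 + 1 / u := by positivity
  rcases le_or_gt (1 / u) 6 with h | h
  · have h1 : Real.log (13 / 10 + 1 / u) ≤ 2 := by
      rw [Real.log_le_iff_le_exp hx]
      have : Real.exp 2 = Real.exp 1 * Real.exp 1 := by rw [← Real.exp_add]; norm_num
      nlinarith
    have h2 : 0 ≤ 1 / (6 * u) := by positivity
    nlinarith
  · set h' := 1 / u with hh
    have h1 : Real.log (13 / 10 + h') ≤ (13 / 10 + h') / 2.7 := by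
      have h2 := Real.log_le_sub_one_of_pos (div_pos hx (Real.exp_pos 1))
      rw [Real.log_div hx.ne' (Real.exp_ne_zero 1), Real.log_exp] at h2
      have h3 : (13 / 10 + h') / Real.exp 1 ≤ (13 / 10 + h') / 2.7 := by
        apply div_le_div_of_nonneg_left hx.le (by norm_num)
        norm_num at he ⊢
        linarith
      linarith
    have hlog0 : 0 ≤ Real.log (13 / 10 + h') := Real.log_nonneg (by linarith)
    have e1 : 2 * u = 2 / h' := by rw [hh]; field_simp
    have e2 : 1 / (6 * u) = h' / 6 := by rw [hh]; field_simp
    have h'0 : 0 < h' := by linarith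
    calc δ * Real.log (13 / 10 + h') ≤ 2 / h' * ((13 / 10 + h') / 2.7) := by
          rw [← e1]
          exact mul_le_mul hδu h1 hlog0 (by positivity)
      _ ≤ h' / 6 := by
          rw [div_mul_div_comm, div_le_div_iff₀ (by positivity) (by norm_num)]
          nlinarith
      _ ≤ _ := by rw [e2]; linarith

namespace SelbergFunction

variable (L : SelbergFunction)

lemma degree_pos : 0 < L.degree := by
  have : Nonempty (Fin L.f) := ⟨⟨0, L.f_pos⟩⟩
  exact mul_pos two_pos (Finset.sum_pos (fun j _ => L.lam_pos j) Finset.univ_nonempty)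

lemma log_lamProd_mul_sq : Real.log |L.lamProd * L.Q ^ 2| =
    2 * (∑ j, L.lam j * Real.log (L.lam j) + Real.log L.Q) := by
  have h : ∀ j, 0 < (L.lam j) ^ (2 * L.lam j) := fun j => Real.rpow_pos_of_pos (L.lam_pos j) _
  rw [Real.log_abs, lamProd, Real.log_mul (Finset.prod_pos fun j _ => h j).ne'
    (pow_pos L.Q_pos 2).ne', Real.log_prod fun j _ => (h j).ne', Real.log_pow, mul_add,
    Finset.mul_sum]
  congr 1
  refine Finset.sum_congr rfl fun j _ => ?_
  rw [Real.log_rpow (L.lam_pos j), mul_assoc]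

lemma two_le_maxShift : 2 ≤ L.maxShift := by
  let j : Fin L.f := ⟨0, L.f_pos⟩
  have h1 : 2 * ‖(L.lam j : ℂ) + conj (L.mu j)‖ / L.lam j ≤ L.maxShift :=
    le_ciSup (f := fun j => 2 * ‖(L.lam j : ℂ) + conj (L.mu j)‖ / L.lam j)
      (Set.finite_range _).bddAbove j
  refine le_trans ?_ h1
  rw [le_div_iff₀ (L.lam_pos j)]
  have h2 := Complex.re_le_norm ((L.lam j : ℂ) + conj (L.mu j))
  simp at h2
  have := L.mu_re_nonneg j
  linarith

lemma norm_mu_le {τ : ℝ} (hτ : L.maxMu ≤ τ) (j : Fin L.f) : ‖L.mu j‖ ≤ L.lam j * (τ / 2) := by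
  have h1 : 2 * ‖L.mu j‖ / L.lam j ≤ L.maxMu :=
    le_ciSup (f := fun j => 2 * ‖L.mu j‖ / L.lam j) (Set.finite_range _).bddAbove j
  have h2 := (div_le_iff₀ (L.lam_pos j)).1 (h1.trans hτ)
  linarith

/-- Only the terms of `V^*` which come from the Bernoulli number are needed. -/
lemma sum_le_VStar {a b T : ℝ} (hT : 0 < T - 2 * (a - b)) (hT' : T - 2 * (a - b) ≤ T) :
    ∑ j, 1 / (6 * (L.lam j * T)) ≤ L.VStar a b T := by
  simp only [VStar]
  rw [Finset.mul_sum]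
  refine Finset.sum_le_sum fun j _ => ?_
  have hj := L.lam_pos j
  rw [bernoulli_two]
  have h6 : (1 : ℝ) / 6 ≤ |((6⁻¹ : ℚ) : ℝ)| / 2 * 2 := by
    rw [abs_of_pos (by norm_num)]; norm_num
  calc 1 / (6 * (L.lam j * T)) = 1 / T * (1 / L.lam j * (1 / 6)) := by
        have : 0 < T := hT.trans_le hT'
        field_simp
    _ ≤ 1 / (T - 2 * (a - b)) * (1 / L.lam j * (|((6⁻¹ : ℚ) : ℝ)| / 2 * 2)) := by gcongr
    _ ≤ _ := by
        gcongr
        have : ∀ x y : ℝ, 0 ≤ y → |((6⁻¹ : ℚ) : ℝ)| / 2 * 2 ≤ x ^ 2 + y +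
            |((6⁻¹ : ℚ) : ℝ)| / 2 * 2 := fun x y hy => by nlinarith [sq_nonneg x]
        refine (this ‖(L.lam j : ℂ) + conj (L.mu j)‖ (2 * ‖((L.lam j : ℂ) + conj (L.mu j)) *
          ((L.lam j : ℂ) + conj (L.mu j) - 1 / 2)‖ + ‖L.mu j‖ ^ 2
          + 2 * ‖L.mu j * (L.mu j - 1 / 2)‖) (by positivity)).trans ?_
        rw [← add_assoc, ← add_assoc]
        gcongr
        exact le_add_of_nonneg_right (sq_nonneg _)

lemma norm_le_exp_of_re_le_neg_two {a₁ T : ℝ} (ha₁ : ∀ n : ℕ, 1 ≤ n → ‖L.coeff n‖ ≤ a₁ * n)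
    (hT : 0 < T) {s : ℂ} (hs : s.re ≤ -2)
    (hpole : ∀ (j : Fin L.f) (n : ℕ), (L.lam j : ℂ) * s + L.mu j ≠ -(n : ℂ))
    (hre : 1 - 2 * s.re ≤ 2 * T)
    (hnorm : ∀ j, ‖(L.lam j : ℂ) * (1 - conj s) + L.mu j + 2‖ ≤ L.lam j * (13 / 5 * T) + 2) :
    ‖L.toFun s‖ ≤ Real.exp (Real.log (a₁ * Real.pi ^ 2 / 6)
      + (1 / 2 - s.re) * Real.log |L.lamProd * L.Q ^ 2|
      + L.degree * (1 / 2 - s.re) * (Real.log (2 * T) + 3)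
      + ∑ j, 1 / (6 * (L.lam j * T))) := by
  have ha1 := L.one_le_coeff_bound ha₁
  have hA : 0 < a₁ * Real.pi ^ 2 / 6 := by positivity
  have hterm : ∀ j, (Real.exp 1 * ‖(L.lam j : ℂ) * (1 - conj s) + L.mu j + 2‖) ^
      (L.lam j * (1 - 2 * s.re)) ≤ Real.exp (L.lam j * (1 - 2 * s.re) *
        (3 + Real.log (2 * T) + Real.log (L.lam j)) + 1 / (6 * (L.lam j * T))) := by
    intro j
    have hj := L.lam_pos j
    have hδ : 0 ≤ L.lam j * (1 - 2 * s.re) := mul_nonneg hj.le (by linarith)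
    have hu : 0 < L.lam j * T := by positivity
    have e : L.lam j * (13 / 5 * T) + 2 = 2 * T * L.lam j * (13 / 10 + 1 / (L.lam j * T)) := by
      field_simp; ring
    have hpos : 0 < 13 / 10 + 1 / (L.lam j * T) := by positivity
    calc _ ≤ (Real.exp 1 * (2 * T * L.lam j * (13 / 10 + 1 / (L.lam j * T)))) ^
          (L.lam j * (1 - 2 * s.re)) := by
          refine Real.rpow_le_rpow (by positivity) ?_ hδ
          rw [← e]
          exact mul_le_mul_of_nonneg_left (hnorm j) (Real.exp_pos 1).le
      _ = Real.exp (L.lam j * (1 - 2 * s.re) * (1 + Real.log (2 * T) + Real.log (L.lam j)) +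
          L.lam j * (1 - 2 * s.re) * Real.log (13 / 10 + 1 / (L.lam j * T))) := by
          rw [Real.rpow_def_of_pos (by positivity), Real.log_mul (Real.exp_ne_zero 1)
            (by positivity), Real.log_exp, Real.log_mul (by positivity) hpos.ne',
            Real.log_mul (by positivity) hj.ne']
          congr 1; ring
      _ ≤ _ := by
          apply Real.exp_le_exp.2
          have := mul_log_add_inv_le hu hδ (by nlinarith)
          linarith
  have h := L.norm_toFun_le_of_re_le_neg_two ha₁ hs hpole
  refine h.trans ?_
  have hprod : ∏ j, (Real.exp 1 * ‖(L.lam j : ℂ) * (1 - conj s) + L.mu j + 2‖) ^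
      (L.lam j * (1 - 2 * s.re)) ≤ ∏ j, Real.exp (L.lam j * (1 - 2 * s.re) *
        (3 + Real.log (2 * T) + Real.log (L.lam j)) + 1 / (6 * (L.lam j * T))) :=
    Finset.prod_le_prod (fun j _ => by positivity) fun j _ => hterm j
  rw [← Real.exp_sum] at hprod
  calc _ ≤ Real.exp (Real.log (a₁ * Real.pi ^ 2 / 6)) * (Real.exp (Real.log L.Q * (1 - 2 * s.re)) *
        Real.exp (∑ j, (L.lam j * (1 - 2 * s.re) *
        (3 + Real.log (2 * T) + Real.log (L.lam j)) + 1 / (6 * (L.lam j * T))))) := by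
        rw [Real.exp_log hA, ← Real.rpow_def_of_pos L.Q_pos]
        have hQ : 0 ≤ L.Q ^ (1 - 2 * s.re) := Real.rpow_nonneg L.Q_pos.le _
        gcongr
    _ = _ := by
        rw [← Real.exp_add, ← Real.exp_add]
        congr 1
        have e : ∑ j, (L.lam j * (1 - 2 * s.re) *
            (3 + Real.log (2 * T) + Real.log (L.lam j)) + 1 / (6 * (L.lam j * T))) =
            (1 - 2 * s.re) * (3 + Real.log (2 * T)) * ∑ j, L.lam j +
            (1 - 2 * s.re) * ∑ j, L.lam j * Real.log (L.lam j) +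
            ∑ j, 1 / (6 * (L.lam j * T)) := by
          rw [Finset.mul_sum, Finset.mul_sum, ← Finset.sum_add_distrib, ← Finset.sum_add_distrib]
          exact Finset.sum_congr rfl fun j _ => by ring
        rw [e, L.log_lamProd_mul_sq, degree]
        ring

lemma norm_le_exp_of_mem_strip {a₁ τ T : ℝ} (ha₁ : ∀ n : ℕ, 1 ≤ n → ‖L.coeff n‖ ≤ a₁ * n)
    (hτ : 0 ≤ τ) (hμ : ∀ j, ‖L.mu j‖ ≤ L.lam j * (τ / 2)) (hT : 5 / 2 ≤ T)
    {s : ℂ} (hs : -2 ≤ s.re) (hs' : s.re ≤ 3) (him : 2 ≤ s.im)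
    (hnorm : ‖s + 5‖ + τ / 2 ≤ 13 / 5 * T) :
    ‖L.toFun s‖ ≤ Real.exp (Real.log (a₁ * Real.pi ^ 2 / 6)
      + max 0 (5 / 2 * Real.log |L.lamProd * L.Q ^ 2| + 15 / 4 * L.degree)
      + L.k * Real.log 4 + 5 / 2 * L.degree * (Real.log (2 * T) + 2)
      + ∑ j, 1 / (6 * (L.lam j * T))) := by
  have ha1 := L.one_le_coeff_bound ha₁
  have hA : 0 < a₁ * Real.pi ^ 2 / 6 := by positivity
  have hT0 : 0 < T := by linarith
  have hterm : ∀ j, ‖s + 5 + ((τ / 2 + 2 / L.lam j : ℝ) : ℂ)‖ ^ (5 * L.lam j) ≤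
      Real.exp (5 * L.lam j * (2 + Real.log (2 * T)) + 1 / (6 * (L.lam j * T))) := by
    intro j
    have hj := L.lam_pos j
    have hu : 0 < L.lam j * T := by positivity
    have hpos : 0 < 13 / 10 + 1 / (L.lam j * T) := by positivity
    have e : 13 / 5 * T + 2 / L.lam j = 2 * T * (13 / 10 + 1 / (L.lam j * T)) := by
      field_simp; ring
    calc _ ≤ (2 * T * (13 / 10 + 1 / (L.lam j * T))) ^ (5 * L.lam j) := by
          refine Real.rpow_le_rpow (norm_nonneg _) ?_ (by positivity)
          rw [← e]
          refine (norm_add_le _ _).trans ?_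
          rw [Complex.norm_real, Real.norm_of_nonneg (by positivity)]
          linarith
      _ = Real.exp (5 * L.lam j * Real.log (2 * T) +
          5 * L.lam j * Real.log (13 / 10 + 1 / (L.lam j * T))) := by
          rw [Real.rpow_def_of_pos (by positivity), Real.log_mul (by positivity) hpos.ne']
          congr 1; ring
      _ ≤ _ := by
          apply Real.exp_le_exp.2
          have := mul_log_add_inv_le hu (δ := 5 * L.lam j) (by positivity) (by nlinarith)
          linarith
  have hprod : ∏ j, ‖s + 5 + ((τ / 2 + 2 / L.lam j : ℝ) : ℂ)‖ ^ (5 * L.lam j) ≤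
      Real.exp (5 / 2 * L.degree * (Real.log (2 * T) + 2) + ∑ j, 1 / (6 * (L.lam j * T))) := by
    refine (Finset.prod_le_prod (fun j _ => by positivity) fun j _ => hterm j).trans (le_of_eq ?_)
    rw [← Real.exp_sum, Finset.sum_add_distrib, ← Finset.sum_mul, ← Finset.mul_sum, degree]
    congr 1; ring
  have hW : L.Q ^ (5 : ℝ) * ∏ j, (Real.exp 1 * (3 / 2 * L.lam j)) ^ (5 * L.lam j) ≤
      Real.exp (5 / 2 * Real.log |L.lamProd * L.Q ^ 2| + 15 / 4 * L.degree) := by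
    have h1 : ∀ j, (Real.exp 1 * (3 / 2 * L.lam j)) ^ (5 * L.lam j) ≤
        Real.exp (5 * L.lam j * (3 / 2) + 5 * (L.lam j * Real.log (L.lam j))) := by
      intro j
      have hj := L.lam_pos j
      rw [Real.rpow_def_of_pos (by positivity), Real.log_mul (Real.exp_ne_zero 1) (by positivity),
        Real.log_exp, Real.log_mul (by norm_num) hj.ne']
      apply Real.exp_le_exp.2
      have := Real.log_le_sub_one_of_pos (by norm_num : (0 : ℝ) < 3 / 2)
      nlinarith
    have h2 : ∏ j, (Real.exp 1 * (3 / 2 * L.lam j)) ^ (5 * L.lam j) ≤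
        ∏ j, Real.exp (5 * L.lam j * (3 / 2) + 5 * (L.lam j * Real.log (L.lam j))) :=
      Finset.prod_le_prod (fun j _ => by have := L.lam_pos j; positivity) fun j _ => h1 j
    rw [← Real.exp_sum] at h2
    calc _ ≤ Real.exp (Real.log L.Q * 5) * Real.exp (∑ j, (5 * L.lam j * (3 / 2) +
          5 * (L.lam j * Real.log (L.lam j)))) := by
          rw [← Real.rpow_def_of_pos L.Q_pos]
          have hQ : 0 ≤ L.Q ^ (5 : ℝ) := Real.rpow_nonneg L.Q_pos.le _
          gcongr
      _ = _ := by
          rw [← Real.exp_add]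
          congr 1
          rw [Finset.sum_add_distrib, ← Finset.sum_mul, ← Finset.mul_sum, ← Finset.mul_sum,
            L.log_lamProd_mul_sq, degree]
          ring
  have hmax : max 1 (L.Q ^ (5 : ℝ) * ∏ j, (Real.exp 1 * (3 / 2 * L.lam j)) ^ (5 * L.lam j)) ≤
      Real.exp (max 0 (5 / 2 * Real.log |L.lamProd * L.Q ^ 2| + 15 / 4 * L.degree)) :=
    max_le (Real.one_le_exp (le_max_left _ _))
      (hW.trans (Real.exp_le_exp.2 (le_max_right _ _)))
  have h4 : (4 : ℝ) ^ L.k = Real.exp (L.k * Real.log 4) := by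
    rw [mul_comm, ← Real.rpow_def_of_pos (by norm_num), Real.rpow_natCast]
  refine (L.norm_toFun_le_of_mem_strip ha₁ hτ hμ hs hs' him).trans ?_
  rw [h4]
  calc _ ≤ Real.exp (Real.log (a₁ * Real.pi ^ 2 / 6)) *
        Real.exp (max 0 (5 / 2 * Real.log |L.lamProd * L.Q ^ 2| + 15 / 4 * L.degree)) *
        (Real.exp (L.k * Real.log 4) * Real.exp (5 / 2 * L.degree * (Real.log (2 * T) + 2) +
          ∑ j, 1 / (6 * (L.lam j * T)))) := by
        rw [Real.exp_log hA]
        have : 0 ≤ ∏ j, ‖s + 5 + ((τ / 2 + 2 / L.lam j : ℝ) : ℂ)‖ ^ (5 * L.lam j) :=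
          Finset.prod_nonneg fun j _ => by positivity
        gcongr
    _ = _ := by
        rw [← Real.exp_add, ← Real.exp_add, ← Real.exp_add]
        congr 1; ring

end SelbergFunction

/-! ### Comparison with `R₂` and the number of zeros of the real part -/

namespace SelbergFunction

variable (L : SelbergFunction)

lemma strip_alternative_le_R2 (a₁ a b T : ℝ) :
    L.degree * (1 / 2 - a + 2 * (a - b)) * Real.log (2 * T) + Real.log (a₁ * Real.pi ^ 2 / 6)
      + L.VStar a b T + (5 / 2 * L.degree + 1) * Real.log 2 + L.k * Real.log 3
      + max 0 (5 / 2 * Real.log |L.lamProd * L.Q ^ 2| + 15 / 4 * L.degree)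
      ≤ Real.log 2 * L.R2 a₁ a b T := by
  have hl2 : 0 < Real.log 2 := Real.log_pos one_lt_two
  have hd := L.degree_pos
  have h5 : 2 ≤ Real.sqrt 5 := Real.le_sqrt_of_sq_le (by norm_num)
  have hm : max 0 (5 / 2 * Real.log |L.lamProd * L.Q ^ 2| + 15 / 4 * L.degree) ≤
      max 0 (5 / 2 * Real.log |L.lamProd * L.Q ^ 2| + 5 * Real.sqrt 5 / 2 * L.degree
        + |L.muSum.im|) := by
    apply max_le_max le_rfl
    nlinarith [abs_nonneg L.muSum.im]
  simp only [R2]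
  rw [← mul_assoc, mul_one_div_cancel hl2.ne', one_mul]
  refine le_trans ?_ (add_le_add le_rfl (le_max_right _ _))
  linarith

lemma left_alternative_le_R2 {a₁ a b T : ℝ} (ha : 2 < a) (hb : b < -3)
    (hT : 0 < T - 2 * (a - b)) :
    L.degree * (1 / 2 - a + 2 * (a - b)) * Real.log (2 * T) + Real.log (a₁ * Real.pi ^ 2 / 6)
      + L.VStar a b T
      + max (5 / 2 * Real.log |L.lamProd * L.Q ^ 2|)
          ((1 / 2 - a + 2 * (a - b)) * Real.log |L.lamProd * L.Q ^ 2|)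
      + L.degree * (2 * (1 / 2 - a + 2 * (a - b)) + 3 / 2)
      ≤ Real.log 2 * L.R2 a₁ a b T := by
  have hl2 : 0 < Real.log 2 := Real.log_pos one_lt_two
  have hd := L.degree_pos
  simp only [R2]
  rw [← mul_assoc, mul_one_div_cancel hl2.ne', one_mul]
  refine le_trans ?_ (add_le_add le_rfl (le_max_left _ _))
  have h1 : 1 ≤ ‖(1 : ℂ) - (((a + 2 * (a - b)) / (T - 2 * (a - b)) : ℝ) : ℂ) * Complex.I‖ := by
    have := Complex.re_le_norm
      ((1 : ℂ) - (((a + 2 * (a - b)) / (T - 2 * (a - b)) : ℝ) : ℂ) * Complex.I)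
    rw [Complex.sub_re, Complex.one_re, Complex.re_ofReal_mul, Complex.I_re, mul_zero,
      sub_zero] at this
    exact this
  have h2 : 0 ≤ (a + 2 * (a - b)) / (T - 2 * (a - b)) * |L.muSum.im / 2| :=
    mul_nonneg (div_nonneg (by linarith) hT.le) (abs_nonneg _)
  have h3 : L.degree * (1 / 2 - a + 2 * (a - b)) ≤
      ‖(1 : ℂ) - (((a + 2 * (a - b)) / (T - 2 * (a - b)) : ℝ) : ℂ) * Complex.I‖
        * L.degree * (1 / 2 - a + 2 * (a - b)) := by
    have h4 : 0 ≤ L.degree * (1 / 2 - a + 2 * (a - b)) := mul_nonneg hd.le (by linarith)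
    rw [mul_assoc]
    exact le_mul_of_one_le_left h4 h1
  nlinarith

/-- The logarithm of the bound for `|L|` on the left half of the circle. The numbers are chosen so
that, after division by `log (2R / (R + 1)) ≥ 1/2`, the zero count stays below `R₂ + 3/2`. -/
noncomputable def logBound (a₁ a b T : ℝ) : ℝ :=
  36 / 25 * (Real.log 2 * L.R2 a₁ a b T) - 47 / 100

lemma log_pi_sq_div_six : 39 / 100 ≤ Real.log (Real.pi ^ 2 / 6) := by
  have hpi := Real.pi_gt_d2
  have h0 : 0 < Real.pi ^ 2 / 6 := by positivity
  have h1 := Real.one_sub_inv_le_log_of_pos h0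
  have h2 : (Real.pi ^ 2 / 6)⁻¹ ≤ 61 / 100 := by
    rw [inv_le_comm₀ h0 (by norm_num)]
    nlinarith
  linarith

lemma three_le_log {x : ℝ} (hx : 24 ≤ x) : 3 ≤ Real.log x := by
  rw [Real.le_log_iff_exp_le (by linarith)]
  have he := Real.exp_one_lt_d9
  have h3 : Real.exp 3 = Real.exp 1 * Real.exp 1 * Real.exp 1 := by
    rw [← Real.exp_add, ← Real.exp_add]; norm_num
  have hp := Real.exp_pos 1
  have h4 : Real.exp 1 * Real.exp 1 ≤ 2.72 * 2.72 := by gcongr <;> linarith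
  rw [h3]
  nlinarith

section

variable {a₁ a b T : ℝ}

lemma log_coeff_bound (ha₁ : ∀ n : ℕ, 1 ≤ n → ‖L.coeff n‖ ≤ a₁ * n) :
    39 / 100 ≤ Real.log (a₁ * Real.pi ^ 2 / 6) := by
  have ha1 := L.one_le_coeff_bound ha₁
  refine log_pi_sq_div_six.trans (Real.log_le_log (by positivity) ?_)
  rw [mul_div_assoc]
  exact le_mul_of_one_le_left (by positivity) ha1

lemma VStar_nonneg (hT : 0 < T - 2 * (a - b)) (hab : b < a) : 0 ≤ L.VStar a b T := by
  refine le_trans (Finset.sum_nonneg fun j _ => ?_) (L.sum_le_VStar hT (by linarith))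
  have := L.lam_pos j
  have : 0 < T := by linarith
  positivity

lemma log_coeff_bound_le_logBound (ha₁ : ∀ n : ℕ, 1 ≤ n → ‖L.coeff n‖ ≤ a₁ * n)
    (ha : 2 < a) (hb : b < -3) (hT : 2 * (a - b) + 2 ≤ T) :
    Real.log (a₁ * Real.pi ^ 2 / 6) ≤ L.logBound a₁ a b T := by
  have h1 := L.strip_alternative_le_R2 a₁ a b T
  have hA := L.log_coeff_bound ha₁
  have hV := L.VStar_nonneg (a := a) (b := b) (T := T) (by linarith) (by linarith)
  have hd := L.degree_pos
  have hl := three_le_log (x := 2 * T) (by linarith)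
  have hl2 := Real.log_two_gt_d9
  have h3 : 0 ≤ L.k * Real.log 3 := mul_nonneg (Nat.cast_nonneg _) (Real.log_nonneg (by norm_num))
  have h4 := le_max_left 0 (5 / 2 * Real.log |L.lamProd * L.Q ^ 2| + 15 / 4 * L.degree)
  have h5 : 0 ≤ L.degree * (1 / 2 - a + 2 * (a - b)) * Real.log (2 * T) :=
    mul_nonneg (mul_nonneg hd.le (by linarith)) (by linarith)
  have h6 : Real.log 2 ≤ (5 / 2 * L.degree + 1) * Real.log 2 := by nlinarith
  norm_num at hl2
  rw [logBound]
  linarith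

lemma norm_le_exp_logBound_left (ha₁ : ∀ n : ℕ, 1 ≤ n → ‖L.coeff n‖ ≤ a₁ * n)
    (ha : 2 < a) (hb : b < -3) (hT₂ : 2 * (a - b) + L.maxShift ≤ T)
    (hT₄ : 2 * (a - b) + L.maxMu < T) {s : ℂ} (hs : s.re ≤ -2)
    (hsph : ‖s - ((a + 1 : ℝ) + T * Complex.I)‖ = 2 * (a - b)) :
    ‖L.toFun s‖ ≤ Real.exp (L.logBound a₁ a b T) := by
  have hT : 2 * (a - b) + 2 ≤ T := by linarith [L.two_le_maxShift]
  have hμ := L.norm_mu_le (τ := T - 2 * (a - b)) (by linarith)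
  have him : T - 2 * (a - b) ≤ s.im := by
    have h := Complex.abs_im_le_norm (s - ((a + 1 : ℝ) + T * Complex.I))
    rw [hsph] at h
    simp at h
    linarith [(abs_le.1 h).1]
  have hre : a + 1 - 2 * (a - b) ≤ s.re := by
    have h := Complex.abs_re_le_norm (s - ((a + 1 : ℝ) + T * Complex.I))
    rw [hsph] at h
    simp at h
    linarith [(abs_le.1 h).1]
  have hpole : ∀ (j : Fin L.f) (n : ℕ), (L.lam j : ℂ) * s + L.mu j ≠ -(n : ℂ) := by
    intro j n h
    have h1 := congrArg Complex.im h
    have h2 := (abs_le.1 ((Complex.abs_im_le_norm (L.mu j)).trans (hμ j))).1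
    have h3 := L.lam_pos j
    simp at h1
    nlinarith
  have h1s : ‖1 - conj s‖ ≤ a + T + 2 * (a - b) := by
    have e : ‖1 - conj s‖ = ‖(s - ((a + 1 : ℝ) + T * Complex.I)) + (a + T * Complex.I)‖ := by
      rw [← RCLike.norm_conj, ← norm_neg]
      congr 1
      simp
      ring
    rw [e]
    refine (norm_add_le _ _).trans ?_
    rw [hsph]
    have h2 : ‖(a : ℂ) + T * Complex.I‖ ≤ a + T := by
      refine (norm_add_le _ _).trans ?_
      rw [norm_mul, Complex.norm_I, mul_one, Complex.norm_real, Complex.norm_real,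
        Real.norm_of_nonneg (by linarith), Real.norm_of_nonneg (by linarith)]
    linarith
  have hnorm : ∀ j, ‖(L.lam j : ℂ) * (1 - conj s) + L.mu j + 2‖ ≤
      L.lam j * (13 / 5 * T) + 2 := by
    intro j
    have hj := L.lam_pos j
    calc _ ≤ ‖(L.lam j : ℂ) * (1 - conj s)‖ + ‖L.mu j‖ + ‖(2 : ℂ)‖ := norm_add₃_le
      _ ≤ L.lam j * (a + T + 2 * (a - b)) + L.lam j * ((T - 2 * (a - b)) / 2) + 2 := by
          rw [norm_mul, Complex.norm_real, Real.norm_of_nonneg hj.le, Complex.norm_ofNat]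
          gcongr
          exact hμ j
      _ = L.lam j * (3 / 2 * T + 2 * a - b) + 2 := by ring
      _ ≤ _ := by
          gcongr
          linarith
  refine (L.norm_le_exp_of_re_le_neg_two ha₁ (by linarith) hs hpole (by linarith) hnorm).trans ?_
  apply Real.exp_le_exp.2
  have h1 := L.strip_alternative_le_R2 a₁ a b T
  have h2 := L.left_alternative_le_R2 (a₁ := a₁) ha hb (T := T) (by linarith)
  have hA := L.log_coeff_bound ha₁
  have hV' := L.sum_le_VStar (a := a) (b := b) (T := T) (by linarith) (by linarith)
  have hV := L.VStar_nonneg (a := a) (b := b) (T := T) (by linarith) (by linarith)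
  have hd := L.degree_pos
  have hl := three_le_log (x := 2 * T) (by linarith)
  have hl2 := Real.log_two_gt_d9
  have h3 : 0 ≤ L.k * Real.log 3 := mul_nonneg (Nat.cast_nonneg _) (Real.log_nonneg (by norm_num))
  have h4 := le_max_left 0 (5 / 2 * Real.log |L.lamProd * L.Q ^ 2| + 15 / 4 * L.degree)
  have h6 : Real.log 2 ≤ (5 / 2 * L.degree + 1) * Real.log 2 := by nlinarith
  set d := L.degree
  set S := 1 / 2 - a + 2 * (a - b) with hS
  set x := 1 / 2 - s.re with hx
  set ell := Real.log |L.lamProd * L.Q ^ 2|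
  set l := Real.log (2 * T)
  have hxS : x ≤ S - 1 := by rw [hx, hS]; linarith
  have hx5 : 5 / 2 ≤ x := by rw [hx]; linarith
  -- `x * ell` lies between its values at the two ends `5/2` and `S` of the range of `x`
  have hmax : x * ell ≤ max (5 / 2 * ell) (S * ell) := by
    rcases le_total 0 ell with h | h
    · exact le_max_of_le_right (mul_le_mul_of_nonneg_right (by linarith) h)
    · exact le_max_of_le_left (mul_le_mul_of_nonpos_right hx5 h)
  have hdS : 0 ≤ d * S := mul_nonneg hd.le (by linarith)
  have h7 : d * x * (l + 3) ≤ d * (S - 1) * (l + 3) := by gcongr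
  have h8 : d * S * 3 ≤ d * S * l := by gcongr
  have h9 : 0 ≤ d * l := mul_nonneg hd.le (by linarith)
  norm_num at hl2
  rw [logBound]
  nlinarith

lemma norm_le_exp_logBound_strip (ha₁ : ∀ n : ℕ, 1 ≤ n → ‖L.coeff n‖ ≤ a₁ * n)
    (ha : 2 < a) (hb : b < -3) (hT₂ : 2 * (a - b) + L.maxShift ≤ T)
    (hT₄ : 2 * (a - b) + L.maxMu < T) {s : ℂ} (hs : -2 ≤ s.re) (hs' : s.re ≤ 3)
    (hsph : ‖s - ((a + 1 : ℝ) + T * Complex.I)‖ = 2 * (a - b)) :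
    ‖L.toFun s‖ ≤ Real.exp (L.logBound a₁ a b T) := by
  have hT : 2 * (a - b) + 2 ≤ T := by linarith [L.two_le_maxShift]
  have hμ := L.norm_mu_le (τ := T - 2 * (a - b)) (by linarith)
  have him := Complex.abs_im_le_norm (s - ((a + 1 : ℝ) + T * Complex.I))
  rw [hsph] at him
  simp at him
  obtain ⟨him1, him2⟩ := abs_le.1 him
  have hs5 : ‖s + 5‖ ≤ 8 + T + 2 * (a - b) := by
    have h := Complex.norm_le_abs_re_add_abs_im (s + 5)
    simp only [Complex.add_re, Complex.add_im, Complex.re_ofNat, Complex.im_ofNat, add_zero] at h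
    rw [abs_of_nonneg (by linarith), abs_of_nonneg (by linarith)] at h
    linarith
  refine (L.norm_le_exp_of_mem_strip (T := T) ha₁ (by linarith) hμ (by linarith) hs hs' (by linarith)
    (by linarith)).trans ?_
  apply Real.exp_le_exp.2
  have h1 := L.strip_alternative_le_R2 a₁ a b T
  have hA := L.log_coeff_bound ha₁
  have hV' := L.sum_le_VStar (a := a) (b := b) (T := T) (by linarith) (by linarith)
  have hV := L.VStar_nonneg (a := a) (b := b) (T := T) (by linarith) (by linarith)
  have hd := L.degree_pos
  have hl := three_le_log (x := 2 * T) (by linarith)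
  have hl2 := Real.log_two_gt_d9
  have h4 := le_max_left 0 (5 / 2 * Real.log |L.lamProd * L.Q ^ 2| + 15 / 4 * L.degree)
  have h6 : Real.log 2 ≤ (5 / 2 * L.degree + 1) * Real.log 2 := by nlinarith
  -- `log 4 ≤ 1.44 log 3`, since `4 ^ 3 ≤ 3 ^ 4`
  have hk : L.k * Real.log 4 ≤ 36 / 25 * (L.k * Real.log 3) := by
    have h43 : Real.log 4 ≤ 4 / 3 * Real.log 3 := by
      have : Real.log ((4 : ℝ) ^ 3) ≤ Real.log ((3 : ℝ) ^ 4) :=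
        Real.log_le_log (by norm_num) (by norm_num)
      rw [Real.log_pow, Real.log_pow] at this
      norm_num at this
      linarith
    have hk0 : (0 : ℝ) ≤ L.k := Nat.cast_nonneg _
    have : 0 ≤ Real.log 3 := Real.log_nonneg (by norm_num)
    nlinarith
  set d := L.degree
  set S := 1 / 2 - a + 2 * (a - b) with hS
  set l := Real.log (2 * T)
  have hS8 : 17 / 2 ≤ S := by rw [hS]; linarith
  have h7 : d * (17 / 2) * l ≤ d * S * l := by gcongr
  have h9 : d * 3 ≤ d * l := by gcongr
  norm_num at hl2
  rw [logBound]
  nlinarith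

/-- The bound on the whole circle of radius `2R` about `a + 1 + iT`. -/
lemma norm_le_exp_logBound (ha₁ : ∀ n : ℕ, 1 ≤ n → ‖L.coeff n‖ ≤ a₁ * n)
    (ha : 2 < a) (hb : b < -3) (hT₂ : 2 * (a - b) + L.maxShift ≤ T)
    (hT₄ : 2 * (a - b) + L.maxMu < T) {s : ℂ}
    (hsph : ‖s - ((a + 1 : ℝ) + T * Complex.I)‖ = 2 * (a - b)) :
    ‖L.toFun s‖ ≤ Real.exp (L.logBound a₁ a b T) := by
  have hT : 2 * (a - b) + 2 ≤ T := by linarith [L.two_le_maxShift]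
  rcases le_total 3 s.re with h | h
  · refine (L.norm_toFun_le_of_three_le_re ha₁ h).trans ?_
    have ha1 := L.one_le_coeff_bound ha₁
    rw [← Real.log_le_iff_le_exp (by positivity)]
    exact L.log_coeff_bound_le_logBound ha₁ ha hb hT
  · rcases le_total (-2) s.re with h' | h'
    · exact L.norm_le_exp_logBound_strip ha₁ ha hb hT₂ hT₄ h' h hsph
    · exact L.norm_le_exp_logBound_left ha₁ ha hb hT₂ hT₄ h' hsph

/-- The number of zeros of `Re L` on the segment `[b, a + 1] + iT`, by Jensen's formula on the circle of
radius `2R` about `a + 1 + iT`; the segment lies within `R + 1` of this centre. -/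
lemma card_re_zeros_le (ha₁ : ∀ n : ℕ, 1 ≤ n → ‖L.coeff n‖ ≤ a₁ * n)
    (ha : 2 < a) (ha_sum : ∑' n : ℕ, a₁ / ((n : ℝ) + 2) ^ a < 1 / 2) (hb : b < -3)
    (hT₂ : 2 * (a - b) + L.maxShift ≤ T) (hT₄ : 2 * (a - b) + L.maxMu < T) (Z : Finset ℝ)
    (hZ : ∀ x ∈ Z, b ≤ x ∧ x ≤ a + 1 ∧ (L.toFun (x + T * Complex.I)).re = 0) :
    (Z.card : ℝ) + 1 / 2 ≤ L.R2 a₁ a b T + 39 / 20 := by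
  have hT : 2 * (a - b) + 2 ≤ T := by linarith [L.two_le_maxShift]
  have hX := L.log_coeff_bound_le_logBound ha₁ ha hb hT
  have hA := L.log_coeff_bound ha₁
  have hone : ∀ s : ℂ, a + 1 ≤ s.re → ‖L.toFun s - 1‖ ≤ 1 / 2 := fun s hs =>
    (L.norm_toFun_sub_one_lt ha₁ ha ha_sum hs).le
  have hshift : ∀ z : ℂ, (z + T * Complex.I) - ((a + 1 : ℝ) + T * Complex.I) =
      z - (a + 1 : ℝ) := fun z => by ring
  have h := card_re_zeros_mul_log_le (F := fun z => L.toFun (z + T * Complex.I)) (c := a + 1)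
    (r := a - b + 1) (ρ := 2 * (a - b)) (A := Real.log (3 / 2)) (B := L.logBound a₁ a b T)
    (by linarith) (by linarith) (fun z hz => by
      have hne : z + T * Complex.I ≠ 1 := fun h => by
        rw [Metric.mem_closedBall, dist_eq_norm] at hz
        have h1 := (Complex.abs_im_le_norm _).trans hz
        have h2 := congrArg Complex.im h
        simp at h1 h2
        have := (abs_le.1 h1).1
        linarith
      exact AnalyticAt.fun_comp (g := L.toFun) (f := fun z : ℂ => z + T * Complex.I)
        (L.analyticAt_toFun hne) (by fun_prop))
    (by
      have h1 := hone ((a + 1 : ℝ) + T * Complex.I) (by simp)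
      have h2 := (abs_le.1 ((Complex.abs_re_le_norm _).trans h1)).1
      rw [Complex.sub_re, Complex.one_re] at h2
      linarith)
    (Real.log_nonneg (by norm_num)) (by linarith)
    (fun z hz hre => by
      rw [Real.exp_log (by norm_num)]
      have h1 := hone (z + T * Complex.I) (by simpa using hre)
      have h2 := norm_add_le (L.toFun (z + T * Complex.I) - 1) 1
      rw [sub_add_cancel, norm_one] at h2
      linarith)
    (fun z hz hre => by
      rw [mem_sphere_iff_norm] at hz
      exact L.norm_le_exp_logBound ha₁ ha hb hT₂ hT₄ (by rw [hshift, hz]))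
    Z (fun x hx => by
      obtain ⟨h1, h2, h3⟩ := hZ x hx
      exact ⟨abs_le.2 ⟨by linarith, by linarith⟩, h3⟩)
  have hratio : 1 / 2 ≤ Real.log (2 * (a - b) / (a - b + 1)) := by
    have h1 : 5 / 3 ≤ 2 * (a - b) / (a - b + 1) := by
      rw [div_le_div_iff₀ (by norm_num) (by linarith)]; linarith
    refine le_trans ?_ (Real.log_le_log (by norm_num) h1)
    rw [Real.le_log_iff_exp_le (by norm_num)]
    have he := Real.exp_one_lt_d9
    have h2 : Real.exp 1 = Real.exp (1 / 2) * Real.exp (1 / 2) := by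
      rw [← Real.exp_add]; norm_num
    by_contra hcon
    push Not at hcon
    nlinarith
  have hc : (Z.card : ℝ) * (1 / 2) ≤ Z.card * Real.log (2 * (a - b) / (a - b + 1)) := by gcongr
  have h32 := Real.log_le_sub_one_of_pos (by norm_num : (0 : ℝ) < 3 / 2)
  have hl2 := Real.log_two_lt_d9
  have hl2' := Real.log_two_gt_d9
  have hR : 0 ≤ L.R2 a₁ a b T := by
    have h0 : 0 ≤ Real.log 2 * L.R2 a₁ a b T := by
      have h1 := hX
      rw [logBound] at h1
      linarith
    exact nonneg_of_mul_nonneg_right h0 (Real.log_pos one_lt_two)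
  rw [logBound] at h
  norm_num at hl2 hl2'
  have h2 : Real.log 2 * L.R2 a₁ a b T ≤ 25 / 36 * L.R2 a₁ a b T := by
    gcongr; linarith
  linarith

end

end SelbergFunction

/-! ### The argument by continuous variation -/

/-- A continuous function with values in `2πℤ` on a connected set is constant. -/
lemma eq_of_exp_mul_I_eq_one {q : ℝ → ℝ} {S : Set ℝ} (hS : IsPreconnected S)
    (hq : ContinuousOn q S) (h1 : ∀ x ∈ S, Complex.exp (q x * Complex.I) = 1) {x y : ℝ}
    (hx : x ∈ S) (hy : y ∈ S) : q x = q y := by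
  have hd : IsDiscrete (AddSubgroup.zmultiples (2 * Real.pi) : Set ℝ) :=
    ⟨inferInstanceAs (DiscreteTopology (AddSubgroup.zmultiples (2 * Real.pi)))⟩
  refine hS.constant_of_mapsTo hd hq (fun z hz => ?_) hx hy
  obtain ⟨n, hn⟩ := Complex.exp_eq_one_iff.1 (h1 z hz)
  refine AddSubgroup.mem_zmultiples_iff.2 ⟨n, ?_⟩
  have h2 : (q z : ℂ) * Complex.I = ((n * (2 * Real.pi) : ℝ) : ℂ) * Complex.I := by
    rw [hn]; push_cast; ring
  have h3 := mul_right_cancel₀ Complex.I_ne_zero h2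
  rw [zsmul_eq_mul]
  exact_mod_cast h3.symm

lemma exp_sub_mul_I_eq_one {w : ℂ} (hw : w ≠ 0) {α β : ℝ}
    (hα : w = (‖w‖ : ℂ) * Complex.exp (α * Complex.I))
    (hβ : w = (‖w‖ : ℂ) * Complex.exp (β * Complex.I)) :
    Complex.exp (((α - β : ℝ) : ℂ) * Complex.I) = 1 := by
  have hn : (‖w‖ : ℂ) ≠ 0 := by exact_mod_cast norm_ne_zero_iff.2 hw
  have h := mul_left_cancel₀ hn (hα.symm.trans hβ)
  rw [Complex.ofReal_sub, sub_mul, Complex.exp_sub, h, div_self (Complex.exp_ne_zero _)]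

namespace IsArgAlongRay

variable {F : ℂ → ℂ} {s : ℂ} {θ θ' : ℝ → ℝ}

lemma eqOn (h : IsArgAlongRay F s θ) (h' : IsArgAlongRay F s θ') {x : ℝ} (hx : s.re ≤ x) :
    θ x = θ' x := by
  have hconst : ∀ y, s.re ≤ y → θ x - θ' x = θ y - θ' y := fun y hy =>
    eq_of_exp_mul_I_eq_one (q := fun x => θ x - θ' x) isPreconnected_Ici
      (h.1.sub h'.1) (fun z hz => exp_sub_mul_I_eq_one (h.2.2 z hz).1 (h.2.2 z hz).2
        (h'.2.2 z hz).2) hx hy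
  have hlim : Tendsto (fun y => θ y - θ' y) atTop (𝓝 0) := by simpa using h.2.1.sub h'.2.1
  have hlim' : Tendsto (fun y => θ y - θ' y) atTop (𝓝 (θ x - θ' x)) := by
    refine tendsto_const_nhds.congr' ?_
    filter_upwards [eventually_ge_atTop s.re] with y hy using hconst y hy
  have := tendsto_nhds_unique hlim' hlim
  linarith

lemma mono (h : IsArgAlongRay F s θ) {s' : ℂ} (hre : s.re ≤ s'.re) (him : s'.im = s.im) :
    IsArgAlongRay F s' θ :=
  ⟨h.1.mono (Set.Ici_subset_Ici.2 hre), h.2.1, fun x hx => by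
    rw [him]; exact h.2.2 x (hre.trans hx)⟩

lemma rayArg_eq (h : IsArgAlongRay F s θ) : rayArg F s = θ s.re := by
  have hex : ∃ θ : ℝ → ℝ, IsArgAlongRay F s θ := ⟨θ, h⟩
  rw [rayArg, dif_pos hex]
  exact hex.choose_spec.eqOn h le_rfl

lemma contArg_eq (h : IsArgAlongRay F s θ) : contArg F s = rayArg F s := by
  rw [contArg, if_pos ⟨θ, h⟩]

lemma re_eq (h : IsArgAlongRay F s θ) {x : ℝ} (hx : s.re ≤ x) :
    (F (x + s.im * Complex.I)).re = ‖F (x + s.im * Complex.I)‖ * Real.cos (θ x) := by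
  conv_lhs => rw [(h.2.2 x hx).2]
  rw [Complex.re_ofReal_mul, Complex.exp_ofReal_mul_I_re]

/-- To the right of the zeros of `Re F`, the argument stays in `(-π/2, π/2)`. -/
lemma abs_lt_pi_div_two (h : IsArgAlongRay F s θ) {c : ℝ}
    (hc : ∀ x : ℝ, c ≤ x → 0 < (F (x + s.im * Complex.I)).re) {x : ℝ} (hx : s.re ≤ x)
    (hcx : c ≤ x) : |θ x| < Real.pi / 2 := by
  by_contra hcon
  push Not at hcon
  have hpi := Real.pi_pos
  have hev := h.2.1.abs
  rw [abs_zero] at hev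
  obtain ⟨y, hy, hxy⟩ := ((hev.eventually (gt_mem_nhds (half_pos hpi))).and
    (eventually_ge_atTop x)).exists
  have hcont : ContinuousOn (fun x => |θ x|) (Set.Icc x y) :=
    (h.1.mono fun z hz => hx.trans hz.1).abs
  obtain ⟨z, hz, hz2⟩ := intermediate_value_Icc' hxy hcont ⟨hy.le, hcon⟩
  have h1 := hc z (hcx.trans hz.1)
  rw [h.re_eq (hx.trans hz.1), ← Real.cos_abs] at h1
  have h2 : |θ z| = Real.pi / 2 := hz2
  rw [h2, Real.cos_pi_div_two, mul_zero] at h1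
  exact lt_irrefl _ h1

/-- If the argument is large, then the real part has many zeros. -/
lemma exists_re_zeros (h : IsArgAlongRay F s θ) {c : ℝ}
    (hc : ∀ x : ℝ, c ≤ x → 0 < (F (x + s.im * Complex.I)).re) {n : ℕ}
    (hn : (n + 1 / 2) * Real.pi ≤ |θ s.re|) :
    ∃ Z : Finset ℝ, Z.card = n + 1 ∧
      ∀ x ∈ Z, s.re ≤ x ∧ x ≤ c ∧ (F (x + s.im * Complex.I)).re = 0 := by
  have hpi := Real.pi_pos
  have hsc : s.re ≤ c := by
    by_contra hcon
    have h1 := h.abs_lt_pi_div_two hc le_rfl (not_le.1 hcon).le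
    have : (0 : ℝ) ≤ n * Real.pi := by positivity
    linarith
  have hθc := h.abs_lt_pi_div_two hc hsc le_rfl
  have hcont : ContinuousOn (fun x => |θ x|) (Set.Icc s.re c) :=
    (h.1.mono fun z hz => hz.1).abs
  have hex : ∀ i : ℕ, ∃ x : ℝ, i ≤ n → x ∈ Set.Icc s.re c ∧ |θ x| = (i + 1 / 2) * Real.pi := by
    intro i
    by_cases hi : i ≤ n
    · have hi' : (i : ℝ) ≤ n := by exact_mod_cast hi
      have h0 : (0 : ℝ) ≤ i * Real.pi := by positivity
      obtain ⟨x, hx, hx2⟩ := intermediate_value_Icc' hsc hcont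
        (show (i + 1 / 2) * Real.pi ∈ Set.Icc |θ c| |θ s.re| from
          ⟨by linarith, by nlinarith⟩)
      exact ⟨x, fun _ => ⟨hx, hx2⟩⟩
    · exact ⟨0, fun hi' => absurd hi' hi⟩
  choose x hx using hex
  refine ⟨(Finset.range (n + 1)).image x, ?_, ?_⟩
  · rw [Finset.card_image_of_injOn, Finset.card_range]
    intro i hi j hj hij
    have h1 := (hx i (by simpa [Nat.lt_succ_iff] using hi)).2
    have h2 := (hx j (by simpa [Nat.lt_succ_iff] using hj)).2
    rw [hij, h2] at h1
    have h3 := mul_right_cancel₀ hpi.ne' h1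
    have h4 : (j : ℝ) = i := by linarith
    exact_mod_cast h4.symm
  · intro z hz
    obtain ⟨i, hi, rfl⟩ := Finset.mem_image.1 hz
    obtain ⟨h1, h2⟩ := hx i (by simpa [Nat.lt_succ_iff] using hi)
    refine ⟨h1.1, h1.2, ?_⟩
    rw [h.re_eq h1.1, ← Real.cos_abs, h2]
    have : Real.cos ((i + 1 / 2) * Real.pi) = 0 := by
      rw [Real.cos_eq_zero_iff]
      exact ⟨i, by push_cast; ring⟩
    rw [this, mul_zero]

/-- The bound for the argument by the number of zeros of the real part. -/
lemma abs_le_of_card_le (h : IsArgAlongRay F s θ) {c M : ℝ}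
    (hc : ∀ x : ℝ, c ≤ x → 0 < (F (x + s.im * Complex.I)).re)
    (hM : ∀ Z : Finset ℝ, (∀ x ∈ Z, s.re ≤ x ∧ x ≤ c ∧ (F (x + s.im * Complex.I)).re = 0) →
      (Z.card : ℝ) + 1 / 2 ≤ M) : |θ s.re| ≤ Real.pi * M := by
  have hpi := Real.pi_pos
  by_contra hcon
  push Not at hcon
  have h0 := hM ∅ (by simp)
  simp only [Finset.card_empty, Nat.cast_zero, zero_add] at h0
  have h1 : M < |θ s.re| / Real.pi := by rw [lt_div_iff₀ hpi]; linarith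
  have h2 : 0 ≤ |θ s.re| / Real.pi - 1 / 2 := by linarith
  have h3 := Nat.floor_le h2
  obtain ⟨Z, hZ, hZ'⟩ := h.exists_re_zeros hc (n := ⌊|θ s.re| / Real.pi - 1 / 2⌋₊) (by
    rw [← le_div_iff₀ hpi]; linarith)
  have h4 := hM Z hZ'
  rw [hZ] at h4
  have h5 := Nat.lt_floor_add_one (|θ s.re| / Real.pi - 1 / 2)
  push_cast at h4
  linarith

end IsArgAlongRay

/-- The argument along a horizontal line, as an explicit integral of the logarithmic derivative:
to the right of `c` it is the principal argument. -/
noncomputable def horizontalArg (F : ℂ → ℂ) (c y x : ℝ) : ℝ :=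
  Complex.arg (F ((max x c : ℝ) + y * Complex.I)) -
    (∫ u in (min x c)..c, deriv F (u + y * Complex.I) / F (u + y * Complex.I)).im

section

variable {F : ℂ → ℂ} {b c : ℝ}

lemma mem_slitPlane_of_norm_sub_one_lt {w : ℂ} (hw : ‖w - 1‖ < 1 / 2) : w ∈ Complex.slitPlane := by
  refine Or.inl ?_
  have h := (abs_le.1 (Complex.abs_re_le_norm (w - 1))).1
  simp at h
  linarith

lemma continuousAt_logDeriv_line {y u : ℝ} (hF : AnalyticAt ℂ F (u + y * Complex.I))
    (h0 : F (u + y * Complex.I) ≠ 0) :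
    ContinuousAt (fun u : ℝ => deriv F (u + y * Complex.I) / F (u + y * Complex.I)) u := by
  have hl : ContinuousAt (fun u : ℝ => (u + y * Complex.I : ℂ)) u := by fun_prop
  exact (ContinuousAt.comp' (f := fun u : ℝ => (u + y * Complex.I : ℂ))
    hF.deriv.continuousAt hl).div (ContinuousAt.comp' (f := fun u : ℝ => (u + y * Complex.I : ℂ))
    hF.continuousAt hl) h0

lemma intervalIntegrable_logDeriv_line {y x : ℝ} (hxc : x ≤ c)
    (hF : ∀ u ∈ Set.Icc x c, AnalyticAt ℂ F (u + y * Complex.I))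
    (h0 : ∀ u ∈ Set.Icc x c, F (u + y * Complex.I) ≠ 0) :
    IntervalIntegrable (fun u : ℝ => deriv F (u + y * Complex.I) / F (u + y * Complex.I))
      volume x c := by
  refine ContinuousOn.intervalIntegrable fun u hu => ?_
  rw [Set.uIcc_of_le hxc] at hu
  exact (continuousAt_logDeriv_line (hF u hu) (h0 u hu)).continuousWithinAt

lemma hasDerivAt_integral_logDeriv_line {y x : ℝ} (hxc : x ≤ c)
    (hF : ∀ u ∈ Set.Icc x c, AnalyticAt ℂ F (u + y * Complex.I))
    (h0 : ∀ u ∈ Set.Icc x c, F (u + y * Complex.I) ≠ 0) :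
    HasDerivAt (fun v : ℝ => ∫ u in v..c, deriv F (u + y * Complex.I) / F (u + y * Complex.I))
      (-(deriv F (x + y * Complex.I) / F (x + y * Complex.I))) x := by
  have hx : x ∈ Set.Icc x c := ⟨le_rfl, hxc⟩
  refine intervalIntegral.integral_hasDerivAt_left (intervalIntegrable_logDeriv_line hxc hF h0) ?_
    (continuousAt_logDeriv_line (hF x hx) (h0 x hx))
  have hl : Continuous fun u : ℝ => (u + y * Complex.I : ℂ) := by fun_prop
  have hev : ∀ᶠ u : ℝ in 𝓝 x, AnalyticAt ℂ F (u + y * Complex.I) ∧ F (u + y * Complex.I) ≠ 0 :=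
    hl.continuousAt.eventually ((hF x hx).eventually_analyticAt.and
      ((hF x hx).continuousAt.eventually_ne (h0 x hx)))
  obtain ⟨S, hS, hSo, hxS⟩ := eventually_nhds_iff.1 hev
  exact ContinuousAt.stronglyMeasurableAtFilter hSo
    (fun u hu => continuousAt_logDeriv_line (hS u hu).1 (hS u hu).2) x hxS

lemma eq_mul_exp_neg_integral_logDeriv {y x : ℝ} (hxc : x ≤ c)
    (hF : ∀ u ∈ Set.Icc x c, AnalyticAt ℂ F (u + y * Complex.I))
    (h0 : ∀ u ∈ Set.Icc x c, F (u + y * Complex.I) ≠ 0) :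
    F (x + y * Complex.I) = F (c + y * Complex.I) *
      Complex.exp (-∫ u in x..c, deriv F (u + y * Complex.I) / F (u + y * Complex.I)) := by
  set J : ℝ → ℂ := fun v => ∫ u in v..c, deriv F (u + y * Complex.I) / F (u + y * Complex.I)
    with hJ
  have hder : ∀ v ∈ Set.Icc x c,
      HasDerivAt (fun v : ℝ => F (v + y * Complex.I) * Complex.exp (J v)) 0 v := by
    intro v hv
    have hsub : Set.Icc v c ⊆ Set.Icc x c := Set.Icc_subset_Icc_left hv.1
    have h1 : HasDerivAt J (-(deriv F (v + y * Complex.I) / F (v + y * Complex.I))) v :=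
      hasDerivAt_integral_logDeriv_line hv.2 (fun u hu => hF u (hsub hu))
        fun u hu => h0 u (hsub hu)
    have h2 : HasDerivAt (fun v : ℝ => (v + y * Complex.I : ℂ)) 1 v := by
      simpa using (Complex.ofRealCLM.hasDerivAt (x := v)).add_const ((y : ℂ) * Complex.I)
    have h3 : HasDerivAt (fun v : ℝ => F (v + y * Complex.I)) (deriv F (v + y * Complex.I)) v := by
      have := (hF v hv).differentiableAt.hasDerivAt.comp v h2
      simpa [Function.comp_def] using this
    have h4 := h3.mul h1.cexp
    have e : deriv F (v + y * Complex.I) * Complex.exp (J v) + F (v + y * Complex.I) *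
        (Complex.exp (J v) * -(deriv F (v + y * Complex.I) / F (v + y * Complex.I))) = 0 := by
      have := h0 v hv
      field_simp
      ring
    rw [← e]
    exact h4
  have hconst := constant_of_has_deriv_right_zero
    (f := fun v : ℝ => F (v + y * Complex.I) * Complex.exp (J v)) (a := x) (b := c)
    (fun v hv => (hder v hv).continuousAt.continuousWithinAt)
    (fun v hv => (hder v ⟨hv.1, hv.2.le⟩).hasDerivWithinAt) c ⟨hxc, le_rfl⟩
  have hJc : J c = 0 := intervalIntegral.integral_same
  simp only [hJc, Complex.exp_zero, mul_one] at hconst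
  rw [hconst, mul_assoc, ← Complex.exp_add, add_neg_cancel, Complex.exp_zero, mul_one]

lemma eq_norm_mul_exp_of_pos {w : ℂ} {r θ : ℝ} (hr : 0 < r)
    (h : w = (r : ℂ) * Complex.exp (θ * Complex.I)) :
    w = (‖w‖ : ℂ) * Complex.exp (θ * Complex.I) := by
  have : ‖w‖ = r := by
    rw [h, norm_mul, Complex.norm_exp_ofReal_mul_I, mul_one, Complex.norm_real,
      Real.norm_of_nonneg hr.le]
  rw [this]
  exact h

lemma horizontalArg_spec {y x : ℝ} (hxc : x ≤ c)
    (hF : ∀ u ∈ Set.Icc x c, AnalyticAt ℂ F (u + y * Complex.I))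
    (h0 : ∀ u ∈ Set.Icc x c, F (u + y * Complex.I) ≠ 0) :
    F (x + y * Complex.I) = (‖F (x + y * Complex.I)‖ : ℂ) *
      Complex.exp (horizontalArg F c y x * Complex.I) := by
  have h := eq_mul_exp_neg_integral_logDeriv hxc hF h0
  rw [horizontalArg, max_eq_right hxc, min_eq_left hxc]
  set J := ∫ u in x..c, deriv F (u + y * Complex.I) / F (u + y * Complex.I)
  have hc0 := h0 c ⟨hxc, le_rfl⟩
  refine eq_norm_mul_exp_of_pos
    (r := ‖F (c + y * Complex.I)‖ * Real.exp (-J.re)) (by positivity) ?_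
  have e : (((Complex.arg (F (c + y * Complex.I)) - J.im : ℝ) : ℂ)) * Complex.I =
      Complex.arg (F (c + y * Complex.I)) * Complex.I + (-J - ((-J.re : ℝ) : ℂ)) := by
    apply Complex.ext <;> simp
    ring
  rw [e, Complex.exp_add, Complex.exp_sub, h]
  conv_lhs => rw [← Complex.norm_mul_exp_arg_mul_I (F (c + y * Complex.I))]
  push_cast
  have := Complex.exp_ne_zero (-(J.re : ℂ))
  field_simp

/-- A function holomorphic and zero-free near a horizontal half-line, close to `1` for `Re ≥ c` and
tending to `1`, has an argument along that half-line. -/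
lemma isArgAlongRay_horizontalArg {σ y : ℝ} (hσ : σ ≤ c)
    (hF : ∀ u : ℝ, σ ≤ u → AnalyticAt ℂ F (u + y * Complex.I))
    (h0 : ∀ u ∈ Set.Icc σ c, F (u + y * Complex.I) ≠ 0)
    (h1 : ∀ z : ℂ, c ≤ z.re → ‖F z - 1‖ < 1 / 2)
    (hlim : Tendsto (fun x : ℝ => F (x + y * Complex.I)) atTop (𝓝 1)) :
    IsArgAlongRay F (σ + y * Complex.I) (horizontalArg F c y) := by
  have hre : (σ + y * Complex.I : ℂ).re = σ := by simp
  have him : (σ + y * Complex.I : ℂ).im = y := by simp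
  rw [IsArgAlongRay, hre, him]
  have hslit : ∀ x : ℝ, c ≤ x → F (x + y * Complex.I) ∈ Complex.slitPlane := fun x hx =>
    mem_slitPlane_of_norm_sub_one_lt (h1 _ (by simpa using hx))
  refine ⟨?_, ?_, ?_⟩
  · refine ContinuousOn.sub ?_ ?_
    · intro x hx
      have hmax : ContinuousAt (fun x : ℝ => (((max x c : ℝ) : ℂ) + y * Complex.I)) x := by
        fun_prop
      have hFc : ContinuousAt F (((max x c : ℝ) : ℂ) + y * Complex.I) :=
        (hF _ (hσ.trans (le_max_right _ _))).continuousAt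
      exact (ContinuousAt.comp' (f := fun x : ℝ => F (((max x c : ℝ) : ℂ) + y * Complex.I))
        (Complex.continuousAt_arg (hslit _ (le_max_right _ _)))
        (ContinuousAt.comp' (f := fun x : ℝ => (((max x c : ℝ) : ℂ) + y * Complex.I))
          hFc hmax)).continuousWithinAt
    · intro x hx
      have hmin : min x c ∈ Set.Icc σ c := ⟨le_min hx hσ, min_le_right _ _⟩
      have hsub : Set.Icc (min x c) c ⊆ Set.Icc σ c := Set.Icc_subset_Icc_left hmin.1
      have hd := (hasDerivAt_integral_logDeriv_line (F := F) (y := y) hmin.2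
        (fun u hu => hF u (hsub hu).1) fun u hu => h0 u (hsub hu)).continuousAt
      have hm : ContinuousAt (fun x : ℝ => min x c) x := by fun_prop
      exact (Complex.continuous_im.continuousAt.comp'
        (ContinuousAt.comp' (f := fun x : ℝ => min x c) hd hm)).continuousWithinAt
  · have harg : Tendsto (fun x : ℝ => Complex.arg (F (x + y * Complex.I))) atTop (𝓝 0) := by
      have := (Complex.continuousAt_arg Complex.one_mem_slitPlane).tendsto.comp hlim
      simpa [Function.comp_def] using this
    refine harg.congr' ?_
    filter_upwards [eventually_ge_atTop c] with x hx
    simp [horizontalArg, hx]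
  · intro x hx
    rcases le_total x c with hxc | hxc
    · have hsub : Set.Icc x c ⊆ Set.Icc σ c := Set.Icc_subset_Icc_left hx
      exact ⟨h0 x ⟨hx, hxc⟩, horizontalArg_spec hxc (fun u hu => hF u (hsub hu).1)
        fun u hu => h0 u (hsub hu)⟩
    · refine ⟨Complex.slitPlane_ne_zero (hslit x hxc), ?_⟩
      simp only [horizontalArg, max_eq_left hxc, min_eq_right hxc, intervalIntegral.integral_same,
        Complex.zero_im, sub_zero]
      exact (Complex.norm_mul_exp_arg_mul_I _).symm

/-- The argument depends continuously on the ordinate, as long as the segment is zero-free. -/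
lemma continuousOn_horizontalArg {σ : ℝ} (hσ : σ ≤ c) {Y : Set ℝ}
    (hF : ∀ y ∈ Y, ∀ u ∈ Set.Icc σ c, AnalyticAt ℂ F (u + y * Complex.I))
    (h0 : ∀ y ∈ Y, ∀ u ∈ Set.Icc σ c, F (u + y * Complex.I) ≠ 0)
    (h1 : ∀ z : ℂ, c ≤ z.re → ‖F z - 1‖ < 1 / 2) :
    ContinuousOn (fun y => horizontalArg F c y σ) Y := by
  rw [continuousOn_iff_continuous_domRestrict]
  simp only [horizontalArg, max_eq_right hσ, min_eq_left hσ, Set.domRestrict_def]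
  refine Continuous.sub ?_ (Complex.continuous_im.comp ?_)
  · rw [continuous_iff_continuousAt]
    intro y
    have hl : ContinuousAt (fun y : Y => (c + (y : ℝ) * Complex.I : ℂ)) y := by fun_prop
    exact ContinuousAt.comp' (f := fun y : Y => F (c + (y : ℝ) * Complex.I))
      (Complex.continuousAt_arg (mem_slitPlane_of_norm_sub_one_lt (h1 _ (by simp))))
      (ContinuousAt.comp' (f := fun y : Y => (c + (y : ℝ) * Complex.I : ℂ))
        (hF y y.2 c ⟨hσ, le_rfl⟩).continuousAt hl)
  · -- extend the integrand continuously past the ends of the segment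
    set f : Y → ℝ → ℂ := fun y u =>
      deriv F ((Set.projIcc σ c hσ u : ℝ) + (y : ℝ) * Complex.I) /
        F ((Set.projIcc σ c hσ u : ℝ) + (y : ℝ) * Complex.I) with hf
    have hcont : Continuous f.uncurry := by
      rw [continuous_iff_continuousAt]
      rintro ⟨y, u⟩
      have hl : ContinuousAt (fun p : Y × ℝ =>
          ((Set.projIcc σ c hσ p.2 : ℝ) + (p.1 : ℝ) * Complex.I : ℂ)) (y, u) := by
        have : Continuous (fun p : Y × ℝ => (Set.projIcc σ c hσ p.2 : ℝ)) :=
          continuous_subtype_val.comp (continuous_projIcc.comp continuous_snd)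
        fun_prop
      have hmem := (Set.projIcc σ c hσ u).2
      exact (ContinuousAt.comp' (f := fun p : Y × ℝ =>
          ((Set.projIcc σ c hσ p.2 : ℝ) + (p.1 : ℝ) * Complex.I : ℂ))
          (hF y y.2 _ hmem).deriv.continuousAt hl).div
        (ContinuousAt.comp' (f := fun p : Y × ℝ =>
          ((Set.projIcc σ c hσ p.2 : ℝ) + (p.1 : ℝ) * Complex.I : ℂ))
          (hF y y.2 _ hmem).continuousAt hl) (h0 y y.2 _ hmem)
    refine (intervalIntegral.continuous_parametric_intervalIntegral_of_continuous' (μ := volume)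
      hcont σ c).congr fun y => ?_
    refine intervalIntegral.integral_congr fun u hu => ?_
    rw [Set.uIcc_of_le hσ] at hu
    simp only [hf, Set.projIcc_of_mem hσ hu]

end

/-! ### The argument as a limit from above -/

lemma mul_eq_polar (z w : ℂ) :
    z * w = ((‖z‖ * ‖w‖ : ℝ) : ℂ) *
      Complex.exp (((Complex.arg z + Complex.arg w : ℝ) : ℂ) * Complex.I) := by
  push_cast
  rw [add_mul, Complex.exp_add, mul_mul_mul_comm, Complex.norm_mul_exp_arg_mul_I,
    Complex.norm_mul_exp_arg_mul_I]

section

variable {F : ℂ → ℂ} {b c : ℝ}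

lemma eventually_ne_zero_punctured (hF : ∀ z : ℂ, 0 < z.im → AnalyticAt ℂ F z)
    (h1 : ∀ z : ℂ, c ≤ z.re → ‖F z - 1‖ < 1 / 2) {z : ℂ} (hz : 0 < z.im) :
    ∀ᶠ w in 𝓝[≠] z, F w ≠ 0 := by
  by_contra hcon
  have hfreq : ∃ᶠ w in 𝓝[≠] z, F w = 0 := hcon
  have hconv : Convex ℝ {z : ℂ | 0 < z.im} := convex_halfSpace_im_gt 0
  have h := AnalyticOnNhd.eqOn_zero_of_preconnected_of_frequently_eq_zero
    (U := {z : ℂ | 0 < z.im}) hF hconv.isPreconnected hz hfreq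
  have h2 : F (c + Complex.I) = 0 := h (by simp)
  have h3 := h1 (c + Complex.I) (by simp)
  rw [h2] at h3
  norm_num at h3

lemma exists_zero_free_strip (hF : ∀ z : ℂ, 0 < z.im → AnalyticAt ℂ F z)
    (h1 : ∀ z : ℂ, c ≤ z.re → ‖F z - 1‖ < 1 / 2) {T : ℝ} (hT : 0 < T) (b : ℝ) :
    ∃ T' > T, ∀ y ∈ Set.Ioo T T', ∀ x ∈ Set.Icc b c, F (x + y * Complex.I) ≠ 0 := by
  have hev : ∀ᶠ y in 𝓝 T, ∀ x ∈ Set.Icc b c, T < y → F (x + y * Complex.I) ≠ 0 := by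
    refine isCompact_Icc.eventually_forall_of_forall_eventually fun x _ => ?_
    have h := eventually_ne_zero_punctured hF h1 (z := x + T * Complex.I) (by simpa using hT)
    rw [eventually_nhdsWithin_iff] at h
    have hl : ContinuousAt (fun p : ℝ × ℝ => (p.2 + p.1 * Complex.I : ℂ)) (T, x) := by fun_prop
    filter_upwards [hl.eventually h] with p hp hTp
    refine hp fun heq => ?_
    have := congrArg Complex.im heq
    simp at this
    linarith
  obtain ⟨l, u, hu, hsub⟩ := mem_nhds_iff_exists_Ioo_subset.1 hev
  exact ⟨u, hu.2, fun y hy x hx => hsub ⟨hu.1.trans hy.1, hy.2⟩ x hx hy.1⟩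

lemma finite_zeros_on_segment (hF : ∀ z : ℂ, 0 < z.im → AnalyticAt ℂ F z)
    (h1 : ∀ z : ℂ, c ≤ z.re → ‖F z - 1‖ < 1 / 2) {T : ℝ} (hT : 0 < T) (b : ℝ) :
    {x ∈ Set.Icc b c | F (x + T * Complex.I) = 0}.Finite := by
  by_contra hinf
  obtain ⟨x, -, hx⟩ := Set.Infinite.exists_accPt_of_subset_isCompact hinf isCompact_Icc
    (Set.sep_subset _ _)
  have h := eventually_ne_zero_punctured hF h1 (z := x + T * Complex.I) (by simpa using hT)
  have hl : Tendsto (fun u : ℝ => (u + T * Complex.I : ℂ)) (𝓝[≠] x) (𝓝[≠] (x + T * Complex.I)) := by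
    refine tendsto_nhdsWithin_of_tendsto_nhds_of_eventually_within _ ?_ ?_
    · have : Continuous fun u : ℝ => (u + T * Complex.I : ℂ) := by fun_prop
      exact (this.tendsto x).mono_left nhdsWithin_le_nhds
    · filter_upwards [self_mem_nhdsWithin] with u hu heq
      exact hu (by have := congrArg Complex.re heq; simpa using this)
  rw [accPt_iff_frequently_nhdsNE] at hx
  obtain ⟨u, hu1, hu2⟩ := (hx.and_eventually (hl.eventually h)).exists
  exact hu2 hu1.2

lemma isArgAlongRay_of_zero_free (hF : ∀ z : ℂ, 0 < z.im → AnalyticAt ℂ F z)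
    (h1 : ∀ z : ℂ, c ≤ z.re → ‖F z - 1‖ < 1 / 2)
    (hlim : ∀ y : ℝ, Tendsto (fun x : ℝ => F (x + y * Complex.I)) atTop (𝓝 1)) {σ y : ℝ}
    (hσ : σ ≤ c) (hy : 0 < y) (h0 : ∀ u ∈ Set.Icc σ c, F (u + y * Complex.I) ≠ 0) :
    IsArgAlongRay F (σ + y * Complex.I) (horizontalArg F c y) :=
  isArgAlongRay_horizontalArg hσ (fun u _ => hF _ (by simpa using hy)) h0 h1 (hlim y)

lemma rayArg_eq_horizontalArg (hF : ∀ z : ℂ, 0 < z.im → AnalyticAt ℂ F z)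
    (h1 : ∀ z : ℂ, c ≤ z.re → ‖F z - 1‖ < 1 / 2)
    (hlim : ∀ y : ℝ, Tendsto (fun x : ℝ => F (x + y * Complex.I)) atTop (𝓝 1)) {σ y : ℝ}
    (hσ : σ ≤ c) (hy : 0 < y) (h0 : ∀ u ∈ Set.Icc σ c, F (u + y * Complex.I) ≠ 0) :
    rayArg F (σ + y * Complex.I) = horizontalArg F c y σ := by
  rw [(isArgAlongRay_of_zero_free hF h1 hlim hσ hy h0).rayArg_eq]
  simp

/-- If `F` is zero-free above the segment from `σ + iT` to `c + iT` and does not vanish at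
`σ + iT`, its argument at `σ + iy` converges as `y → T+`: it differs by a constant from a local
branch of the argument near `σ + iT`. -/
lemma exists_tendsto_horizontalArg (hF : ∀ z : ℂ, 0 < z.im → AnalyticAt ℂ F z)
    (h1 : ∀ z : ℂ, c ≤ z.re → ‖F z - 1‖ < 1 / 2) {σ T T' : ℝ}
    (hσ : σ ≤ c) (hT : 0 < T) (hTT' : T < T')
    (h0 : ∀ y ∈ Set.Ioo T T', ∀ u ∈ Set.Icc σ c, F (u + y * Complex.I) ≠ 0)
    (hσ0 : F (σ + T * Complex.I) ≠ 0) :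
    ∃ l, Tendsto (fun y => horizontalArg F c y σ) (𝓝[>] T) (𝓝 l) := by
  set w := F (σ + T * Complex.I) with hw
  have hline : Continuous fun y : ℝ => (σ + y * Complex.I : ℂ) := by fun_prop
  have hcontT : ∀ y : ℝ, 0 < y → ContinuousAt (fun y : ℝ => F (σ + y * Complex.I) / w) y :=
    fun y hy => (ContinuousAt.comp' (f := fun y : ℝ => (σ + y * Complex.I : ℂ))
      (hF (σ + y * Complex.I) (by simpa using hy)).continuousAt hline.continuousAt).div_const w
  have hwT : F (σ + T * Complex.I) / w = 1 := div_self hσ0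
  have hev : ∀ᶠ y : ℝ in 𝓝 T, F (σ + y * Complex.I) / w ∈ Complex.slitPlane :=
    (hcontT T hT).eventually_mem (by
      rw [hwT]; exact Complex.isOpen_slitPlane.mem_nhds Complex.one_mem_slitPlane)
  obtain ⟨l, u, hu, hsub⟩ := mem_nhds_iff_exists_Ioo_subset.1 hev
  set T₁ := min u T'
  have hT₁ : T < T₁ := lt_min hu.2 hTT'
  set p : ℝ → ℝ := fun y => Complex.arg (F (σ + y * Complex.I) / w) + Complex.arg w with hp
  have hslit : ∀ y ∈ Set.Ico T T₁, F (σ + y * Complex.I) / w ∈ Complex.slitPlane := fun y hy =>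
    hsub ⟨hu.1.trans_le hy.1, hy.2.trans_le (min_le_left _ _)⟩
  have hpc : ∀ y ∈ Set.Ico T T₁, ContinuousAt p y := fun y hy =>
    (ContinuousAt.comp' (f := fun y : ℝ => F (σ + y * Complex.I) / w)
      (Complex.continuousAt_arg (hslit y hy)) (hcontT y (hT.trans_le hy.1))).add_const _
  have hpexp : ∀ y ∈ Set.Ico T T₁, F (σ + y * Complex.I) =
      (‖F (σ + y * Complex.I)‖ : ℂ) * Complex.exp (p y * Complex.I) := by
    intro y hy
    have hne := Complex.slitPlane_ne_zero (hslit y hy)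
    refine eq_norm_mul_exp_of_pos (r := ‖F (σ + y * Complex.I) / w‖ * ‖w‖) (by positivity) ?_
    have e : F (σ + y * Complex.I) = F (σ + y * Complex.I) / w * w := (div_mul_cancel₀ _ hσ0).symm
    exact e.trans (mul_eq_polar _ _)
  have hcont : ContinuousOn (fun y => horizontalArg F c y σ) (Set.Ioo T T₁) :=
    continuousOn_horizontalArg hσ
      (fun y hy u _ => hF _ (by simpa using hT.trans hy.1))
      (fun y hy => h0 y ⟨hy.1, hy.2.trans_le (min_le_right _ _)⟩) h1
  have hIoo : ∀ y ∈ Set.Ioo T T₁, y ∈ Set.Ico T T₁ := fun y hy => ⟨hy.1.le, hy.2⟩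
  set y₀ := (T + T₁) / 2
  have hy₀ : y₀ ∈ Set.Ioo T T₁ := ⟨by simp only [y₀]; linarith, by simp only [y₀]; linarith⟩
  have hconst : ∀ y ∈ Set.Ioo T T₁, horizontalArg F c y σ - p y =
      horizontalArg F c y₀ σ - p y₀ := by
    intro y hy
    refine eq_of_exp_mul_I_eq_one (q := fun y => horizontalArg F c y σ - p y)
      isPreconnected_Ioo (hcont.sub fun z hz => (hpc z (hIoo z hz)).continuousWithinAt)
      (fun z hz => ?_) hy hy₀
    have hz0 := h0 z ⟨hz.1, hz.2.trans_le (min_le_right _ _)⟩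
    exact exp_sub_mul_I_eq_one (hz0 σ ⟨le_rfl, hσ⟩)
      (horizontalArg_spec hσ (fun u _ => hF _ (by simpa using hT.trans hz.1)) hz0)
      (hpexp z (hIoo z hz))
  refine ⟨p T + (horizontalArg F c y₀ σ - p y₀), ?_⟩
  have hpT : Tendsto (fun y => p y + (horizontalArg F c y₀ σ - p y₀)) (𝓝[>] T)
      (𝓝 (p T + (horizontalArg F c y₀ σ - p y₀))) :=
    ((hpc T ⟨le_rfl, hT₁⟩).tendsto.mono_left nhdsWithin_le_nhds).add_const _
  refine hpT.congr' ?_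
  filter_upwards [Ioo_mem_nhdsGT hT₁] with y hy
  rw [← hconst y hy]
  ring

lemma tendsto_add_nhdsGT (T : ℝ) : Tendsto (fun ε : ℝ => T + ε) (𝓝[>] 0) (𝓝[>] T) := by
  refine tendsto_nhdsWithin_of_tendsto_nhds_of_eventually_within _ ?_ ?_
  · have : Continuous fun ε : ℝ => T + ε := by fun_prop
    simpa using (this.tendsto 0).mono_left nhdsWithin_le_nhds
  · filter_upwards [self_mem_nhdsWithin] with ε hε
    have : 0 < ε := hε
    simp only [Set.mem_Ioi]
    linarith

/-- Away from the zeros on the line itself, `contArg` is always the limit of `rayArg` from above,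
whether or not there are zeros on the half-line. -/
lemma tendsto_rayArg_contArg (hF : ∀ z : ℂ, 0 < z.im → AnalyticAt ℂ F z)
    (h1 : ∀ z : ℂ, c ≤ z.re → ‖F z - 1‖ < 1 / 2)
    (hlim : ∀ y : ℝ, Tendsto (fun x : ℝ => F (x + y * Complex.I)) atTop (𝓝 1)) {σ T : ℝ}
    (hσ : σ ≤ c) (hT : 0 < T) (hσ0 : F (σ + T * Complex.I) ≠ 0) :
    Tendsto (fun ε : ℝ => rayArg F (σ + (T + ε : ℝ) * Complex.I)) (𝓝[>] 0)
      (𝓝 (contArg F (σ + T * Complex.I))) := by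
  obtain ⟨T', hTT', h0⟩ := exists_zero_free_strip hF h1 hT σ
  have hreduce : ∀ l, Tendsto (fun y => horizontalArg F c y σ) (𝓝[>] T) (𝓝 l) →
      Tendsto (fun ε : ℝ => rayArg F (σ + (T + ε : ℝ) * Complex.I)) (𝓝[>] 0) (𝓝 l) := by
    intro l hl
    have h2 : Tendsto (fun y : ℝ => rayArg F (σ + y * Complex.I)) (𝓝[>] T) (𝓝 l) := by
      refine hl.congr' ?_
      filter_upwards [Ioo_mem_nhdsGT hTT'] with y hy
      exact (rayArg_eq_horizontalArg hF h1 hlim hσ (hT.trans hy.1) (h0 y hy)).symm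
    exact h2.comp (tendsto_add_nhdsGT T)
  by_cases hz : ∀ u ∈ Set.Icc σ c, F (u + T * Complex.I) ≠ 0
  · have hcont : ContinuousOn (fun y => horizontalArg F c y σ) (Set.Ico T T') :=
      continuousOn_horizontalArg hσ
        (fun y hy u _ => hF _ (by simpa using hT.trans_le hy.1))
        (fun y hy => by
          rcases hy.1.eq_or_lt with h | h
          · rw [← h]; exact hz
          · exact h0 y ⟨h, hy.2⟩) h1
    have hray := isArgAlongRay_of_zero_free hF h1 hlim hσ hT hz
    rw [hray.contArg_eq, rayArg_eq_horizontalArg hF h1 hlim hσ hT hz]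
    refine hreduce _ ?_
    have h2 := hcont T ⟨le_rfl, hTT'⟩
    have h3 : 𝓝[>] T ≤ 𝓝[Set.Ico T T'] T := by
      rw [← nhdsWithin_Ioo_eq_nhdsGT hTT']
      exact nhdsWithin_mono _ Set.Ioo_subset_Ico_self
    exact h2.tendsto.mono_left h3
  · have hno : ¬ ∃ θ : ℝ → ℝ, IsArgAlongRay F (σ + T * Complex.I) θ := by
      rintro ⟨θ, hθ⟩
      refine hz fun u hu => ?_
      have := (hθ.2.2 u (by simpa using hu.1)).1
      simpa using this
    obtain ⟨l, hl⟩ := exists_tendsto_horizontalArg hF h1 hσ hT hTT' h0 hσ0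
    have h2 := hreduce l hl
    have e : contArg F (σ + T * Complex.I) = l := by
      rw [contArg, if_neg hno]
      refine Tendsto.limUnder_eq (h2.congr fun ε => ?_)
      congr 1
      push_cast; ring
    rw [e]
    exact h2

end

/-! ### The integral of the argument -/

namespace SelbergFunction

variable (L : SelbergFunction) {a₁ a b T : ℝ}

lemma continuousAt_R2 (hT : 0 < T) (hT' : T - 2 * (a - b) ≠ 0) :
    ContinuousAt (fun t => L.R2 a₁ a b t) T := by
  have hinv : ContinuousAt (fun t : ℝ => 1 / (t - 2 * (a - b))) T :=
    continuousAt_const.div (by fun_prop) hT'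
  have hV : ContinuousAt (fun t => L.VStar a b t) T := by
    simp only [VStar]
    exact hinv.mul continuousAt_const
  have hlog : ContinuousAt (fun t : ℝ => Real.log (2 * t)) T :=
    ContinuousAt.log (by fun_prop) (by positivity)
  have hq : ContinuousAt (fun t : ℝ => (a + 2 * (a - b)) / (t - 2 * (a - b))) T :=
    continuousAt_const.div (by fun_prop) hT'
  simp only [R2]
  fun_prop

lemma abs_rayArg_le (ha₁ : ∀ n : ℕ, 1 ≤ n → ‖L.coeff n‖ ≤ a₁ * n)
    (ha : 2 < a) (ha_sum : ∑' n : ℕ, a₁ / ((n : ℝ) + 2) ^ a < 1 / 2) (hb : b < -3)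
    (hT₂ : 2 * (a - b) + L.maxShift ≤ T) (hT₄ : 2 * (a - b) + L.maxMu < T) {σ : ℝ}
    (hσ : b ≤ σ) {θ : ℝ → ℝ} (h : IsArgAlongRay L.toFun (σ + T * Complex.I) θ) :
    |rayArg L.toFun (σ + T * Complex.I)| ≤ Real.pi * (L.R2 a₁ a b T + 39 / 20) := by
  rw [h.rayArg_eq]
  have hre : (σ + T * Complex.I : ℂ).re = σ := by simp
  have him : (σ + T * Complex.I : ℂ).im = T := by simp
  refine h.abs_le_of_card_le (c := a + 1) (fun x hx => ?_) fun Z hZ => ?_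
  · have h1 := L.norm_toFun_sub_one_lt ha₁ ha ha_sum
      (s := x + (σ + T * Complex.I : ℂ).im * Complex.I) (by simpa using hx)
    have h2 := (abs_le.1 (Complex.abs_re_le_norm
      (L.toFun (x + (σ + T * Complex.I : ℂ).im * Complex.I) - 1))).1
    rw [Complex.sub_re, Complex.one_re] at h2
    linarith
  · refine L.card_re_zeros_le ha₁ ha ha_sum hb hT₂ hT₄ Z fun x hx => ?_
    have h1 := hZ x hx
    rw [hre, him] at h1
    exact ⟨hσ.trans h1.1, h1.2⟩

lemma exists_sequence_from_above {T T' : ℝ} (h : T < T') :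
    ∃ ε : ℕ → ℝ, Tendsto ε atTop (𝓝[>] 0) ∧ ∀ n, T + ε n ∈ Set.Ioo T T' := by
  obtain ⟨ε, -, hε, hlim⟩ := exists_seq_strictAnti_tendsto' (sub_pos.2 h)
  refine ⟨ε, tendsto_nhdsWithin_of_tendsto_nhds_of_eventually_within _ hlim
    (Eventually.of_forall fun n => (hε n).1), fun n => ⟨?_, ?_⟩⟩
  · linarith [(hε n).1]
  · linarith [(hε n).2]

end SelbergFunction

theorem theoremI32 (L : SelbergFunction) (a₁ a b T : ℝ)
    (ha₁ : ∀ n : ℕ, 1 ≤ n → ‖L.coeff n‖ ≤ a₁ * n)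
    (ha : 2 < a) (ha_sum : ∑' n : ℕ, a₁ / ((n : ℝ) + 2) ^ a < 1 / 2)
    (hb : b < -3) (hb_sum : ∑' n : ℕ, a₁ / ((n : ℝ) + 2) ^ (-b - 1) < 1)
    (hT₁ : 2 * (a - b) + 1 ≤ T)
    (hT₂ : 2 * (a - b) + L.maxShift ≤ T)
    (hT₃ : 0 < L.k → 2 * (a - b) + 1 / ((2 : ℝ) ^ (1 / (L.k : ℝ)) - 1) ≤ T)
    (hT₄ : 2 * (a - b) + L.maxMu < T) :
    IntervalIntegrable (fun σ : ℝ => contArg L.toFun ((σ : ℂ) + (T : ℂ) * Complex.I))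
        volume b a ∧
      |L.I3 T a b| < Real.pi * (a - b) * (L.R2 a₁ a b T + 2) := by
  have hpi := Real.pi_pos
  have hab : b ≤ a := by linarith
  have hT0 : 0 < T := by linarith
  have hF : ∀ z : ℂ, 0 < z.im → AnalyticAt ℂ L.toFun z := fun z hz =>
    L.analyticAt_toFun fun h => by rw [h] at hz; simp at hz
  have h1 : ∀ z : ℂ, a + 1 ≤ z.re → ‖L.toFun z - 1‖ < 1 / 2 := fun z hz =>
    L.norm_toFun_sub_one_lt ha₁ ha ha_sum hz
  have hlim : ∀ y : ℝ, Tendsto (fun x : ℝ => L.toFun (x + y * Complex.I)) atTop (𝓝 1) := by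
    intro y
    rw [← L.coeff_one ha₁]
    exact L.tendsto_toFun_coeff_one ha₁ ha y
  obtain ⟨T', hTT', h0⟩ := exists_zero_free_strip hF h1 hT0 b
  obtain ⟨ε, hε, hεT⟩ := SelbergFunction.exists_sequence_from_above hTT'
  have hpos : ∀ n, 0 < T + ε n := fun n => hT0.trans (hεT n).1
  -- the arguments just above the line, where the whole segment is zero-free
  have hray : ∀ n, ∀ σ ∈ Set.Icc b a, IsArgAlongRay L.toFun (σ + (T + ε n : ℝ) * Complex.I)
      (horizontalArg L.toFun (a + 1) (T + ε n)) := fun n σ hσ =>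
    isArgAlongRay_of_zero_free hF h1 hlim (by linarith [hσ.2]) (hpos n) fun u hu =>
      h0 _ (hεT n) u ⟨hσ.1.trans hu.1, hu.2⟩
  have hbound : ∀ n, ∀ σ ∈ Set.Icc b a, |rayArg L.toFun (σ + (T + ε n : ℝ) * Complex.I)| ≤
      Real.pi * (L.R2 a₁ a b (T + ε n) + 39 / 20) := fun n σ hσ =>
    L.abs_rayArg_le ha₁ ha ha_sum hb (hT₂.trans (hεT n).1.le) (hT₄.trans (hεT n).1) hσ.1
      (hray n σ hσ)
  have hcont : ∀ n, ContinuousOn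
      (fun σ : ℝ => rayArg L.toFun (σ + (T + ε n : ℝ) * Complex.I)) (Set.Icc b a) := by
    intro n
    have hb' := hray n b ⟨le_rfl, hab⟩
    have h2 : ContinuousOn (horizontalArg L.toFun (a + 1) (T + ε n)) (Set.Icc b a) :=
      hb'.1.mono fun x hx => by simpa using hx.1
    refine h2.congr fun σ hσ => ?_
    rw [(hray n σ hσ).rayArg_eq]
    simp
  have hεR : Tendsto (fun n => L.R2 a₁ a b (T + ε n)) atTop (𝓝 (L.R2 a₁ a b T)) := by
    have h2 := (L.continuousAt_R2 (a₁ := a₁) (a := a) (b := b) hT0 (by linarith)).tendsto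
    exact h2.comp (((tendsto_add_nhdsGT T).mono_right nhdsWithin_le_nhds).comp hε)
  -- off the finite set of zeros on the line, the arguments above the line converge to `contArg`
  set N : Set ℝ := {x ∈ Set.Icc b (a + 1) | L.toFun (x + T * Complex.I) = 0} with hN
  have hNnull : volume N = 0 := (finite_zeros_on_segment hF h1 hT0 b).measure_zero volume
  have hconv : ∀ σ ∈ Set.Icc b a, σ ∉ N → Tendsto
      (fun n => rayArg L.toFun (σ + (T + ε n : ℝ) * Complex.I)) atTop
      (𝓝 (contArg L.toFun (σ + T * Complex.I))) := by
    intro σ hσ hσN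
    have hσ1 : σ ≤ a + 1 := by linarith [hσ.2]
    exact (tendsto_rayArg_contArg hF h1 hlim hσ1 hT0 fun h => hσN ⟨⟨hσ.1, hσ1⟩, h⟩).comp hε
  have hlimbound : ∀ σ ∈ Set.Icc b a, σ ∉ N →
      ‖contArg L.toFun (σ + T * Complex.I)‖ ≤ Real.pi * (L.R2 a₁ a b T + 39 / 20) := by
    intro σ hσ hσN
    exact le_of_tendsto_of_tendsto (hconv σ hσ hσN).abs
      ((hεR.add_const _).const_mul _) (Eventually.of_forall fun n => hbound n σ hσ)
  have hNae : ∀ᵐ σ ∂(volume : Measure ℝ), σ ∉ N := measure_eq_zero_iff_ae_notMem.1 hNnull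
  have hae : ∀ᵐ σ ∂(volume.restrict (Set.Icc b a)), σ ∈ Set.Icc b a ∧ σ ∉ N :=
    (ae_restrict_mem measurableSet_Icc).and (ae_restrict_of_ae hNae)
  constructor
  · rw [intervalIntegrable_iff_integrableOn_Icc_of_le hab]
    have hmeas : AEStronglyMeasurable
        (fun σ : ℝ => contArg L.toFun (σ + T * Complex.I)) (volume.restrict (Set.Icc b a)) := by
      refine aestronglyMeasurable_of_tendsto_ae atTop
        (fun n => (hcont n).aestronglyMeasurable measurableSet_Icc) ?_
      filter_upwards [hae] with σ hσ using hconv σ hσ.1 hσ.2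
    refine IntegrableOn.of_bound (by simp) hmeas (Real.pi * (L.R2 a₁ a b T + 39 / 20)) ?_
    filter_upwards [hae] with σ hσ using hlimbound σ hσ.1 hσ.2
  · have hle : ‖L.I3 T a b‖ ≤ Real.pi * (L.R2 a₁ a b T + 39 / 20) * |a - b| := by
      refine intervalIntegral.norm_integral_le_of_norm_le_const_ae ?_
      filter_upwards [hNae] with σ hσ hmem
      rw [Set.uIoc_of_le hab] at hmem
      exact hlimbound σ ⟨hmem.1.le, hmem.2⟩ hσ
    rw [abs_of_pos (by linarith)] at hle
    refine lt_of_le_of_lt hle ?_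
    have : 0 < Real.pi * (a - b) := mul_pos hpi (by linarith)
    nlinarith
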